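/- Let $K$ be an algebraically closed field of characteristic zero, let $r \ge 1$ and $d \ge 2r-1$ be integers, and set $k = d-(2r-2)$. Definitions. For $n \ge 1$ let $W_n$ be the family $Y_n \subset \mathbb{P}^1 \times \mathbb{A}^{n-1} \to (\mathbb{A}^{n-1},0)$ given by $s^n + a_{n-2}s^{n-2}t^2 + \dots + a_0 t^n = 0$, where $a_0,\dots,a_{n-2}$ are the coordinates of $\mathbb{A}^{n-1}$ and $[s:t]$ those of $\mathbb{P}^1$ (the miniversal unfolding of the singularity $z^n=0$; for $n=1$ it is $s=0$ over a point). Let $(B,b)$ be a smooth pointed variety and $Z \subset \mathbb{P}^1 \times B$ a divisor whose fibre over $b$ is $m_1p_1 + \dots + m_lp_l$ with distinct points $p_j \in \mathbb{P}^1$ and $m_j \ge 1$. An unfolding map for $Z$ at $b$ is a morphism $\mu : (U,u) \to \bigl(\prod_j \mathbb{A}^{m_j-1},0\bigr)$ from an étale neighbourhood $(U,u)$ of $b$ such that $Z_U$ is a disjoint union of closed subschemes $Z_1,\dots,Z_l \subset \mathbb{P}^1 \times U$ and each $Z_j \subset \mathbb{P}^1\times U$ is isomorphic to the pullback of $W_{m_j}$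 under the $j$-th component of $\mu$. The family $Z$ is versal (respectively mini-versal) at $b$ if unfolding maps exist, and any of them (that is, some and every one) is surjective on tangent spaces at $u$ (respectively is a local isomorphism at $u$ in the étale sense, i.e. is étale at $u$). For a hypersurface $X \subset \mathbb{P}^r$, the point-line incidence correspondence is $\Sigma = \{(x,[\ell]) : x \in X,\ x \in \ell\}$, a subscheme of the tautological $\mathbb{P}^1$-bundle over the Grassmannian $\mathbb{G}(1,r)$ of lines in $\mathbb{P}^r$; it is said to be versal (mini-versal) at $[\ell]$ if it is so in the standard affine charts $\mathbb{A}^{2(r-1)}$ of $\mathbb{G}(1,r)$ centred at $[\ell]$, where the tautological bundle is trivial. A line $\ell$ is $k$-incident to $X$ if the set $X \cap \ell$ consists of exactly $k$ points. Statement. There is a non-empty Zariski open subset of the projective space of hypersurfaces of degree $d$ in $\mathbb{P}^r$ such that, for every $X$ in it and every line $\ell$ that is $k$-incident to $X$, the point-line incidence correspondence $\Sigma \to \mathbb{G}(1,r)$ is versal, and in fact mini-versal, at $[\ell]$: with $X\cdot \ell = m_1p_1 + \dots + m_kp_k$, there are unfolding maps from étale neighbourhoods of $[\ell]$ to $\prod_{i=1}^k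 \mathbb{A}^{m_i-1}$, and every one of them is a local isomorphism at the marked point. -/

import Mathlib

open scoped LinearAlgebra.Projectivization

noncomputable section

namespace PointLine

universe u

/-! ## Closed subschemes of `ℙ¹` over an affine base and the unfoldings `W_n`

A homogeneous form in `MvPolynomial (Fin 2) A` defines a closed subscheme of `ℙ¹_A`; the homogeneous
coordinates `[s : t]` are `X 0` and `X 1`. -/

/-- The form `s ^ n + ∑_{i ≤ n - 2} a_i s ^ i t ^ (n - i)`.  For `n ≥ 1` and `a` the coordinates of
`𝔸^(n-1)` it defines the unfolding `W_n` of `z ^ n = 0`; for `a` functions on `Spec A`, it defines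
the pullback of `W_n` along `a : Spec A → 𝔸^(n-1)`. -/
def unfolding {A : Type*} [CommRing A] (n : ℕ) (a : Fin (n - 1) → A) : MvPolynomial (Fin 2) A :=
  MvPolynomial.X 0 ^ n +
    ∑ i : Fin (n - 1), MvPolynomial.C (a i) * MvPolynomial.X 0 ^ (i : ℕ) *
      MvPolynomial.X 1 ^ (n - (i : ℕ))

/-- The form `Q` obtained from `P` by the linear change of homogeneous coordinates `g` on `ℙ¹_A`. -/
def changeCoord {A : Type*} [CommRing A] (g : GL (Fin 2) A) (P : MvPolynomial (Fin 2) A) :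
    MvPolynomial (Fin 2) A :=
  MvPolynomial.aeval
    (fun i : Fin 2 => ∑ j : Fin 2, MvPolynomial.C (g.val i j) * MvPolynomial.X j) P

/-- The subschemes of `ℙ¹_A` defined by `P` and `Q` correspond to each other under an automorphism
of `ℙ¹_A` over `A` given by an invertible matrix. -/
def SameUpToCoord {A : Type*} [CommRing A] (P Q : MvPolynomial (Fin 2) A) : Prop :=
  ∃ (g : GL (Fin 2) A) (c : Aˣ), changeCoord g P = MvPolynomial.C (c : A) * Q

/-- The subschemes of `ℙ¹_A` defined by the forms `P` and `Q` do not meet. -/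
def DisjointZeros {A : Type*} [CommRing A] (P Q : MvPolynomial (Fin 2) A) : Prop :=
  Ideal.span {MvPolynomial.X 0, MvPolynomial.X 1} ≤ (Ideal.span {P, Q}).radical

/-- The coordinate ring of `∏_j 𝔸^(m_j - 1)`. -/
abbrev UnfoldingBase (K : Type u) [Field K] {k : ℕ} (m : Fin k → ℕ) : Type u :=
  MvPolynomial (Σ j : Fin k, Fin (m j - 1)) K

/-- The origin of `∏_j 𝔸^(m_j - 1)`, as a `K`-point. -/
def unfoldingOrigin (K : Type u) [Field K] {k : ℕ} (m : Fin k → ℕ) : UnfoldingBase K m →ₐ[K] K :=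
  MvPolynomial.aeval (fun _ => (0 : K))

/-! ## Étale neighbourhoods, tangent maps, local isomorphisms

The base is `B = Spec R`, with `R` a (smooth) `K`-algebra, and a `K`-point of `B` is a `K`-algebra
homomorphism `b : R →ₐ[K] K`. -/

/-- An (affine) étale neighbourhood of the point `b` of `Spec R`, with a point above `b`. -/
structure EtaleNbhd {K R : Type u} [Field K] [CommRing R] [Algebra K R] (b : R →ₐ[K] K) where
  /-- The coordinate ring of the neighbourhood. -/
  ring : Type u
  [commRing : CommRing ring]
  [algebra : Algebra K ring]
  [algebraBase : Algebra R ring]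
  [tower : IsScalarTower K R ring]
  [etale : Algebra.Etale R ring]
  /-- The marked point. -/
  point : ring →ₐ[K] K
  point_over : ∀ x : R, point (algebraMap R ring x) = b x

attribute [instance] EtaleNbhd.commRing EtaleNbhd.algebra EtaleNbhd.algebraBase EtaleNbhd.tower
  EtaleNbhd.etale

/-- The tangent space of `Spec A` at the `K`-point `p`: the morphisms `Spec K[ε] → Spec A` whose
restriction to the closed point is `p`. -/
def TangentSpace {K A : Type*} [Field K] [CommRing A] [Algebra K A] (p : A →ₐ[K] K) : Type _ :=
  {v : A →ₐ[K] DualNumber K // (TrivSqZeroExt.fstHom K K K).comp v = p}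

/-- The map induced on tangent spaces by the morphism of affine schemes with coordinate map `f`. -/
def tangentMap {K A C : Type*} [Field K] [CommRing A] [Algebra K A] [CommRing C] [Algebra K C]
    (f : C →ₐ[K] A) (p : A →ₐ[K] K) (v : TangentSpace p) : TangentSpace (p.comp f) :=
  ⟨v.val.comp f, by rw [← AlgHom.comp_assoc, v.property]⟩

/-- The morphism with coordinate map `f` is a local submersion at `p`: it is surjective on tangent
spaces. -/
def IsSubmersionAt {K A C : Type*} [Field K] [CommRing A] [Algebra K A] [CommRing C] [Algebra K C]
    (f : C →ₐ[K] A) (p : A →ₐ[K] K) : Prop :=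
  Function.Surjective (tangentMap f p)

/-- The morphism with coordinate map `f` is a local isomorphism at `p` for the étale topology: it is
étale on a basic open neighbourhood of `p`. -/
def IsLocalIsoAt {K A C : Type*} [Field K] [CommRing A] [Algebra K A] [CommRing C] [Algebra K C]
    (f : C →ₐ[K] A) (p : A →ₐ[K] K) : Prop :=
  ∃ h : A, p h ≠ 0 ∧ ((algebraMap A (Localization.Away h)).comp f.toRingHom).Etale

/-! ## Versality of a family of divisors in `ℙ¹` -/

/-- The fibre over `b` of the subscheme of `ℙ¹_R` defined by `Z` is the divisor `∑_j m_j p_j`, with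
distinct points `p_j` of `ℙ¹` and positive `m_j`. -/
def HasFibre {K R : Type u} [Field K] [CommRing R] [Algebra K R] (b : R →ₐ[K] K)
    (Z : MvPolynomial (Fin 2) R) {k : ℕ} (m : Fin k → ℕ) : Prop :=
  (∀ j, 0 < m j) ∧ ∃ (p : Fin k → ℙ K (Fin 2 → K)) (c : K), Function.Injective p ∧ c ≠ 0 ∧
    MvPolynomial.map b.toRingHom Z = MvPolynomial.C c *
      ∏ j, (MvPolynomial.C ((p j).rep 1) * MvPolynomial.X 0 -
        MvPolynomial.C ((p j).rep 0) * MvPolynomial.X 1) ^ m j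

/-- `μ : (U, u) → (∏_j 𝔸^(m_j - 1), 0)` is a pointed morphism such that `Z_U` is a disjoint union of
subschemes `Z_j` of `ℙ¹_U`, where `Z_j ⊂ ℙ¹_U` is isomorphic to the pullback of `W_{m_j}` under the
`j`-th component of `μ`. -/
def IsUnfoldingMap {K R : Type u} [Field K] [CommRing R] [Algebra K R] {b : R →ₐ[K] K}
    (Z : MvPolynomial (Fin 2) R) {k : ℕ} (m : Fin k → ℕ) (U : EtaleNbhd b)
    (μ : UnfoldingBase K m →ₐ[K] U.ring) : Prop :=
  U.point.comp μ = unfoldingOrigin K m ∧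
  ∃ Zc : Fin k → MvPolynomial (Fin 2) U.ring,
    (∃ c : U.ringˣ,
      MvPolynomial.map (algebraMap R U.ring) Z = MvPolynomial.C (c : U.ring) * ∏ j, Zc j) ∧
    (∀ i j, i ≠ j → DisjointZeros (Zc i) (Zc j)) ∧
    ∀ j, SameUpToCoord (Zc j) (unfolding (m j) (fun i => μ (MvPolynomial.X ⟨j, i⟩)))

/-- The subscheme of `ℙ¹_R` defined by `Z` is versal at `b`: its fibre over `b` is `∑_j m_j p_j`, and
any (that is, some and every) map to `∏_j 𝔸^(m_j - 1)` inducing `Z` étale-locally at `b` is a local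
submersion. -/
def IsVersalAt {K R : Type u} [Field K] [CommRing R] [Algebra K R] (b : R →ₐ[K] K)
    (Z : MvPolynomial (Fin 2) R) : Prop :=
  ∃ (k : ℕ) (m : Fin k → ℕ), HasFibre b Z m ∧
    (∃ (U : EtaleNbhd b) (μ : UnfoldingBase K m →ₐ[K] U.ring),
      IsUnfoldingMap Z m U μ ∧ IsSubmersionAt μ U.point) ∧
    ∀ (U : EtaleNbhd b) (μ : UnfoldingBase K m →ₐ[K] U.ring),
      IsUnfoldingMap Z m U μ → IsSubmersionAt μ U.point

/-- The subscheme of `ℙ¹_R` defined by `Z` is mini-versal at `b`: its fibre over `b` is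
`∑_j m_j p_j`, and any (that is, some and every) map to `∏_j 𝔸^(m_j - 1)` inducing `Z` étale-locally
at `b` is a local isomorphism. -/
def IsMiniVersalAt {K R : Type u} [Field K] [CommRing R] [Algebra K R] (b : R →ₐ[K] K)
    (Z : MvPolynomial (Fin 2) R) : Prop :=
  ∃ (k : ℕ) (m : Fin k → ℕ), HasFibre b Z m ∧
    (∃ (U : EtaleNbhd b) (μ : UnfoldingBase K m →ₐ[K] U.ring),
      IsUnfoldingMap Z m U μ ∧ IsLocalIsoAt μ U.point) ∧
    ∀ (U : EtaleNbhd b) (μ : UnfoldingBase K m →ₐ[K] U.ring),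
      IsUnfoldingMap Z m U μ → IsLocalIsoAt μ U.point

/-! ## Lines, the Grassmannian and the point-line correspondence -/

/-- The lines in `ℙ^r`, i.e. the points of `𝔾(1, r)`: the two-dimensional subspaces of
`K^(r+1)`. -/
def Line (K : Type u) [Field K] (r : ℕ) : Type u :=
  {L : Submodule K (Fin (r + 1) → K) // Module.finrank K L = 2}

/-- The line `L` is `k`-incident to the hypersurface `F = 0`: it meets it in exactly `k` points. -/
def IsIncident {K : Type u} [Field K] {r : ℕ} (F : MvPolynomial (Fin (r + 1)) K) (k : ℕ)
    (L : Line K r) : Prop :=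
  {p : ℙ K (Fin (r + 1) → K) | p.submodule ≤ L.val ∧ MvPolynomial.eval p.rep F = 0}.encard = k

/-- A basis of `K^(r+1)` whose first two vectors span the line `L`.  It gives the standard affine
chart `𝔸^(2(r-1))` of `𝔾(1, r)` centred at `L`: the point `a` is the line spanned by the vectors
`e_i + ∑_j a_{i,j} e'_j`, `i = 0, 1`. -/
def IsAdapted {K : Type u} [Field K] {r : ℕ} (L : Line K r)
    (e : Module.Basis (Fin 2 ⊕ Fin (r - 1)) K (Fin (r + 1) → K)) : Prop :=
  L.val = Submodule.span K {e (Sum.inl 0), e (Sum.inl 1)}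

/-- The coordinate ring of an affine chart `𝔸^(2(r-1))` of `𝔾(1, r)`. -/
abbrev ChartRing (K : Type u) [Field K] (r : ℕ) : Type u := MvPolynomial (Fin 2 × Fin (r - 1)) K

/-- The centre of the chart. -/
def chartCentre (K : Type u) [Field K] (r : ℕ) : ChartRing K r →ₐ[K] K :=
  MvPolynomial.aeval (fun _ => (0 : K))

/-- The frame `e_i + ∑_j a_{i,j} e'_j`, `i = 0, 1`, of the tautological rank-two bundle over the
chart; it identifies the tautological `ℙ¹`-bundle there with `ℙ¹ × 𝔸^(2(r-1))`. -/
def tautFrame {K : Type u} [Field K] {r : ℕ}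
    (e : Module.Basis (Fin 2 ⊕ Fin (r - 1)) K (Fin (r + 1) → K)) (i : Fin 2) :
    Fin (r + 1) → ChartRing K r :=
  fun l => MvPolynomial.C (e (Sum.inl i) l) +
    ∑ j : Fin (r - 1), MvPolynomial.X (i, j) * MvPolynomial.C (e (Sum.inr j) l)

/-- The equation of `Σ ⊂ ℙ¹ × 𝔸^(2(r-1))` over the chart: the equation `F` of the hypersurface
evaluated at the point `s v_0 + t v_1` of the line spanned by the tautological frame `v_0, v_1`. -/
def incidenceForm {K : Type u} [Field K] {r : ℕ} (F : MvPolynomial (Fin (r + 1)) K)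
    (e : Module.Basis (Fin 2 ⊕ Fin (r - 1)) K (Fin (r + 1) → K)) :
    MvPolynomial (Fin 2) (ChartRing K r) :=
  MvPolynomial.aeval
    (fun l => ∑ i : Fin 2, MvPolynomial.C (tautFrame e i l) * MvPolynomial.X i) F

/-- The point-line correspondence of `F = 0` is versal at the line `L`. -/
def IsVersalAtLine {K : Type u} [Field K] {r : ℕ} (F : MvPolynomial (Fin (r + 1)) K)
    (L : Line K r) : Prop :=
  ∀ e : Module.Basis (Fin 2 ⊕ Fin (r - 1)) K (Fin (r + 1) → K), IsAdapted L e →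
    IsVersalAt (chartCentre K r) (incidenceForm F e)

/-- The point-line correspondence of `F = 0` is mini-versal at the line `L`. -/
def IsMiniVersalAtLine {K : Type u} [Field K] {r : ℕ} (F : MvPolynomial (Fin (r + 1)) K)
    (L : Line K r) : Prop :=
  ∀ e : Module.Basis (Fin 2 ⊕ Fin (r - 1)) K (Fin (r + 1) → K), IsAdapted L e →
    IsMiniVersalAt (chartCentre K r) (incidenceForm F e)

/-- `P` holds for a general hypersurface of degree `d` in `ℙ^r`: it holds for every hypersurface in
a non-empty basic open subset of the projective space of forms of degree `d`. -/
def ForGeneralHypersurface (K : Type u) [Field K] (r d : ℕ)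
    (P : MvPolynomial (Fin (r + 1)) K → Prop) : Prop :=
  ∃ (n : ℕ) (Φ : MvPolynomial {α : Fin (r + 1) →₀ ℕ // α.degree = d} K),
    Φ ≠ 0 ∧ Φ.IsHomogeneous n ∧
    ∀ F : MvPolynomial (Fin (r + 1)) K, F.IsHomogeneous d → F ≠ 0 →
      MvPolynomial.eval (fun α => F.coeff α.val) Φ ≠ 0 → P F

end PointLine

end

/-!
In the chart of the Grassmannian centred at a line `ℓ` with `X · ℓ = ∑ m_j p_j`, an unfolding map
goes from an étale neighbourhood of the centre of `𝔸^(2(r-1))` to `∏_j 𝔸^(m_j - 1)`. As `ℓ` is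
`k`-incident with `k = d - (2r - 2)`, both sides have the same dimension `d - k = 2(r - 1)`. So by
the Jacobian criterion (`isLocalIsoAt_and_isSubmersionAt_of_tangent`) it suffices that the tangent
map be injective; versality and mini-versality then hold together.

Unfolding maps exist at every point where the family of binary forms does not vanish
(`exists_isUnfoldingMap`): the factorization of the fibre into powers of distinct linear forms lifts
to an étale neighbourhood, by the universal coprime factorization ring, and a Tschirnhaus shift
brings each factor to the form
`s ^ n + ∑_{i ≤ n - 2} a_i s ^ i t ^ (n - i)`.

A tangent vector annihilated by an unfolding map is a first-order motion of `ℓ`, over `K[ε]`, along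
which the equation of `X` remains a product `c ∏_j L_j ^ m_j` with linear forms `L_j` over `K[ε]`
(`IsUnfoldingMap.exists_map_eq`). A frame of such a motion, if the motion is not trivial, is called
a bad frame (`BadFrame`), and the theorem is reduced to the fact that the forms of degree `d` having
a bad frame lie in a hypersurface (`exists_hypersurface_of_badFrame`).

This is a dimension count. In suitable coordinates `(s, t, y)` the line is `y = 0`, the form `F`
restricts to `c ∏_j (s - α_j t) ^ m_j` on it, and a bad frame gives a nontrivial relation
`g ∣ ∑ (v_{0,j} z + v_{1,j}) ∂F/∂y_j (z, 1, 0)`, where `g = ∏_j (z - α_j) ^ (m_j - 1)` has degree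
`2(r - 1)`, the number of the unknowns `v_{i,j}`. Hence the determinant of a square matrix over the
parameter space vanishes (`chartDiscriminant`); that it is not identically zero is seen from an
explicit form (`sampleForm`). The parameters are the `2(r - 1)` coordinates of the line, the `k`
roots, the factor `c`, and the coefficients of `F` at the monomials involving some `y_j`; the first
`2(r - 1) + k + 1 = d + 1` are as many as the monomials in `s` and `t`, so the parameter space has
the dimension of the space of all forms. The image of a hypersurface under a polynomial map to an
affine space of the same dimension lies in a hypersurface, by transcendence degree
(`exists_ne_zero_eval_eq_zero`). Finitely many charts, choices of a point at infinity on the line,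
and multiplicity vectors suffice, and since the forms with a bad frame are a cone, the resulting
polynomial may be taken homogeneous.
-/

open scoped LinearAlgebra.Projectivization

noncomputable section

namespace PointLine

universe u

/-! ### The Jacobian criterion for étale morphisms -/

/-- For `K → C → A` with `A` formally smooth over `K`, the Jacobi–Zariski sequence shows that `A` is
formally étale over `C` as soon as the differentials of `C` freely generate those of `A`. -/
theorem formallyEtale_of_bijective_mapBaseChange {K C A : Type*} [CommRing K] [CommRing C]
    [CommRing A] [Algebra K C] [Algebra K A] [Algebra C A] [IsScalarTower K C A]
    [Algebra.FormallySmooth K A]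
    (h : Function.Bijective (KaehlerDifferential.mapBaseChange K C A)) :
    Algebra.FormallyEtale C A := by
  refine ⟨?_, ?_⟩
  · refine ⟨fun x y => ?_⟩
    have h0 : ∀ z : Ω[A⁄C], z = 0 := by
      intro z
      obtain ⟨w, rfl⟩ := KaehlerDifferential.map_surjective K C A z
      exact (KaehlerDifferential.exact_mapBaseChange_map K C A w).mpr (h.2 w)
    rw [h0 x, h0 y]
  · refine ⟨fun x y => ?_⟩
    have h0 : ∀ z : Algebra.H1Cotangent C A, z = 0 := by
      intro z
      have h1 : Algebra.H1Cotangent.δ K C A z = 0 := by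
        apply h.1
        rw [map_zero]
        exact (Algebra.H1Cotangent.exact_δ_mapBaseChange K C A _).mpr ⟨z, rfl⟩
      obtain ⟨w, rfl⟩ := (Algebra.H1Cotangent.exact_map_δ K C A z).mp h1
      rw [Subsingleton.elim w 0, map_zero]
    rw [h0 x, h0 y]

/-- The basis `dX_i` of the differentials of an étale algebra over a polynomial ring. -/
def kaehlerBasis (K : Type*) {σ A : Type*} [CommRing K] [CommRing A]
    [Algebra K A] [Algebra (MvPolynomial σ K) A] [IsScalarTower K (MvPolynomial σ K) A]
    [Algebra.FormallyEtale (MvPolynomial σ K) A] : Module.Basis σ A (Ω[A⁄K]) :=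
  ((KaehlerDifferential.mvPolynomialBasis K σ).baseChange A).map
    (KaehlerDifferential.tensorKaehlerEquivOfFormallyEtale K (MvPolynomial σ K) A)

theorem kaehlerBasis_apply {K σ A : Type*} [CommRing K] [CommRing A]
    [Algebra K A] [Algebra (MvPolynomial σ K) A] [IsScalarTower K (MvPolynomial σ K) A]
    [Algebra.FormallyEtale (MvPolynomial σ K) A] (i : σ) :
    kaehlerBasis K (A := A) i = KaehlerDifferential.D K A
      (algebraMap (MvPolynomial σ K) A (MvPolynomial.X i)) := by
  simp [kaehlerBasis]

/-- An algebra étale over `K[X_σ]` is étale over `K[Y_σ]` if the differentials of the `Y_j` are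
expressed through those of the `X_i` by a matrix with invertible determinant. -/
theorem etale_of_isUnit_jacobian {K σ τ A : Type*} [CommRing K] [CommRing A] [Fintype σ]
    [DecidableEq σ] [Finite τ]
    [Algebra K A] [Algebra (MvPolynomial σ K) A] [IsScalarTower K (MvPolynomial σ K) A]
    [Algebra.Etale (MvPolynomial σ K) A]
    [Algebra (MvPolynomial τ K) A] [IsScalarTower K (MvPolynomial τ K) A]
    (e : σ ≃ τ) (J : Matrix σ σ A)
    (hJ : ∀ j, KaehlerDifferential.D K A
      (algebraMap (MvPolynomial τ K) A (MvPolynomial.X (e j))) =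
        ∑ i, J i j • KaehlerDifferential.D K A
          (algebraMap (MvPolynomial σ K) A (MvPolynomial.X i)))
    (hdet : IsUnit J.det) : Algebra.Etale (MvPolynomial τ K) A := by
  have : Algebra.FormallySmooth K A := Algebra.FormallySmooth.comp K (MvPolynomial σ K) A
  have : Algebra.FinitePresentation K A := Algebra.FinitePresentation.trans K (MvPolynomial σ K) A
  have : Algebra.FinitePresentation (MvPolynomial τ K) A :=
    Algebra.FinitePresentation.of_restrict_scalars_finitePresentation K _ _
  let b := ((KaehlerDifferential.mvPolynomialBasis K τ).baseChange A).reindex e.symm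
  let b' : Module.Basis σ A (Ω[A⁄K]) := kaehlerBasis K
  have hmat : LinearMap.toMatrix b b' (KaehlerDifferential.mapBaseChange K (MvPolynomial τ K) A)
      = J := by
    ext i j
    rw [LinearMap.toMatrix_apply]
    have h1 : KaehlerDifferential.mapBaseChange K (MvPolynomial τ K) A (b j) =
        ∑ i, J i j • b' i := by
      simp only [b, b', kaehlerBasis_apply, ← hJ]
      simp
    rw [h1]
    simp [Finsupp.single_apply]
  have hbij : Function.Bijective (KaehlerDifferential.mapBaseChange K (MvPolynomial τ K) A) :=
    (LinearEquiv.ofIsUnitDet (f := KaehlerDifferential.mapBaseChange K (MvPolynomial τ K) A)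
      (v := b) (v' := b') (by rw [hmat]; exact hdet)).bijective
  exact { formallyEtale := formallyEtale_of_bijective_mapBaseChange hbij }

/-- The tangent vector `a ↦ p a + ε d a` given by a derivation `d` at the point `p`. -/
def tangentOfDerivation {K A : Type*} [Field K] [CommRing A] [Algebra K A] (p : A →ₐ[K] K)
    (d : A →ₗ[K] K) (hd : ∀ a b, d (a * b) = p a * d b + p b * d a) : TangentSpace p :=
  ⟨AlgHom.ofLinearMap
    ((TrivSqZeroExt.inlAlgHom K K K).toLinearMap.comp p.toLinearMap +
      (TrivSqZeroExt.inrHom K K).comp d)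
    (by
      have h1 : d 1 = 0 := by simpa using hd 1 1
      ext <;> simp [h1])
    (fun a b => by
      ext
      · simp
      · simp [hd, mul_comm]), by
    ext a
    simp⟩

theorem tangentOfDerivation_apply {K A : Type*} [Field K] [CommRing A] [Algebra K A]
    (p : A →ₐ[K] K) (d : A →ₗ[K] K) (hd : ∀ a b, d (a * b) = p a * d b + p b * d a) (a : A) :
    (tangentOfDerivation p d hd).val a = TrivSqZeroExt.inl (p a) + TrivSqZeroExt.inr (d a) :=
  rfl

theorem TangentSpace.fst_apply {K A : Type*} [Field K] [CommRing A] [Algebra K A] {p : A →ₐ[K] K}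
    (v : TangentSpace p) (a : A) : (v.val a).fst = p a :=
  DFunLike.congr_fun v.property a

section

variable {K σ A : Type*} [Field K] [CommRing A] [Fintype σ] [Algebra K A]
  [Algebra (MvPolynomial σ K) A] [IsScalarTower K (MvPolynomial σ K) A]
  [Algebra.FormallyEtale (MvPolynomial σ K) A]

/-- On an algebra étale over `K[X_σ]`, there is a tangent vector at `p` with prescribed values
`ε w_i` on the `X_i`. -/
def tangentOfCoords (p : A →ₐ[K] K) (w : σ → K) : TangentSpace p :=
  tangentOfDerivation p
    { toFun := fun a =>
        ∑ i, p ((kaehlerBasis (σ := σ) K).repr (KaehlerDifferential.D K A a) i) * w i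
      map_add' := fun a b => by simp [add_mul, Finset.sum_add_distrib]
      map_smul' := fun c a => by
        rw [Derivation.map_smul, ← algebraMap_smul A c, map_smul]
        simp [Finset.mul_sum, mul_assoc] }
    (fun a b => by
      simp [Finset.mul_sum, mul_assoc, add_mul, Finset.sum_add_distrib])

theorem tangentOfCoords_snd (p : A →ₐ[K] K) (w : σ → K) (a : A) :
    ((tangentOfCoords p w).val a).snd =
      ∑ i, p ((kaehlerBasis (σ := σ) K).repr (KaehlerDifferential.D K A a) i) * w i := by
  rw [tangentOfCoords, tangentOfDerivation_apply]
  simp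

theorem tangentOfCoords_snd_X [DecidableEq σ] (p : A →ₐ[K] K) (w : σ → K) (i : σ) :
    ((tangentOfCoords p w).val (algebraMap (MvPolynomial σ K) A (MvPolynomial.X i))).snd = w i := by
  rw [tangentOfCoords_snd, ← kaehlerBasis_apply]
  simp [Finsupp.single_apply, apply_ite p]

end

/-- A morphism from an étale `𝔸^σ`-scheme to an affine space of the same dimension that kills no
nonzero tangent vector at `p` is a submersion and a local isomorphism at `p`. -/
theorem isLocalIsoAt_and_isSubmersionAt_of_tangent {K σ τ A : Type*} [Field K] [CommRing A]
    [Finite σ] [Finite τ] [Algebra K A] [Algebra (MvPolynomial σ K) A]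
    [IsScalarTower K (MvPolynomial σ K) A] [Algebra.Etale (MvPolynomial σ K) A]
    (e : σ ≃ τ) (f : MvPolynomial τ K →ₐ[K] A) (p : A →ₐ[K] K)
    (H : ∀ v : TangentSpace p, (∀ j, (v.val (f (MvPolynomial.X j))).snd = 0) →
      ∀ i, (v.val (algebraMap (MvPolynomial σ K) A (MvPolynomial.X i))).snd = 0) :
    IsLocalIsoAt f p ∧ IsSubmersionAt f p := by
  classical
  have := Fintype.ofFinite σ
  let J : Matrix σ σ A := fun i j =>
    (kaehlerBasis (σ := σ) K).repr (KaehlerDifferential.D K A (f (MvPolynomial.X (e j)))) i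
  let Jp : Matrix σ σ K := J.map p
  have hsnd : ∀ (w : σ → K) (j : σ),
      ((tangentOfCoords p w).val (f (MvPolynomial.X (e j)))).snd = Matrix.vecMul w Jp j := by
    intro w j
    rw [tangentOfCoords_snd]
    exact Finset.sum_congr rfl fun i _ => mul_comm _ _
  have hdet : Jp.det ≠ 0 := by
    intro h0
    obtain ⟨w, hw, hw0⟩ := Matrix.exists_vecMul_eq_zero_iff.mpr h0
    refine hw (funext fun i => ?_)
    rw [← tangentOfCoords_snd_X (A := A) p w i]
    refine H _ (fun j => ?_) i
    obtain ⟨j, rfl⟩ := e.surjective j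
    rw [hsnd, hw0]
    rfl
  have hpdet : p J.det ≠ 0 := by
    rw [AlgHom.map_det]
    exact hdet
  refine ⟨⟨J.det, hpdet, ?_⟩, ?_⟩
  · let g := (algebraMap A (Localization.Away J.det)).comp f.toRingHom
    let : Algebra (MvPolynomial τ K) (Localization.Away J.det) := g.toAlgebra
    have : IsScalarTower K (MvPolynomial τ K) (Localization.Away J.det) := by
      refine IsScalarTower.of_algebraMap_eq fun x => ?_
      change _ = algebraMap A (Localization.Away J.det) (f (algebraMap K _ x))
      rw [f.commutes, ← IsScalarTower.algebraMap_apply]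
    have : Algebra.Etale (MvPolynomial σ K) (Localization.Away J.det) := inferInstance
    change Algebra.Etale (MvPolynomial τ K) (Localization.Away J.det)
    refine etale_of_isUnit_jacobian (K := K) (σ := σ) e
      (J.map (algebraMap A (Localization.Away J.det))) (fun j => ?_) ?_
    · have h1 : KaehlerDifferential.D K A (f (MvPolynomial.X (e j))) =
          ∑ i, J i j • KaehlerDifferential.D K A
            (algebraMap (MvPolynomial σ K) A (MvPolynomial.X i)) := by
        simp_rw [← kaehlerBasis_apply]
        exact ((kaehlerBasis (σ := σ) K).sum_repr _).symm
      have h2 := congrArg (KaehlerDifferential.map K K A (Localization.Away J.det)) h1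
      rw [KaehlerDifferential.map_D] at h2
      refine h2.trans ?_
      rw [map_sum]
      refine Finset.sum_congr rfl fun i _ => ?_
      rw [map_smul, KaehlerDifferential.map_D, ← IsScalarTower.algebraMap_apply,
        Matrix.map_apply, algebraMap_smul]
    · rw [← RingHom.mapMatrix_apply, ← RingHom.map_det]
      exact IsLocalization.Away.algebraMap_isUnit _
  · intro t
    have hunit : IsUnit Jp.det := isUnit_iff_ne_zero.mpr hdet
    refine ⟨tangentOfCoords p
      (Matrix.vecMul (fun j => (t.val (MvPolynomial.X (e j))).snd) Jp⁻¹), ?_⟩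
    refine Subtype.ext (MvPolynomial.algHom_ext fun j => ?_)
    obtain ⟨j, rfl⟩ := e.surjective j
    refine TrivSqZeroExt.ext ?_ ?_
    · rw [TangentSpace.fst_apply, TangentSpace.fst_apply]
    · change ((tangentOfCoords p _).val (f (MvPolynomial.X (e j)))).snd = _
      rw [hsnd, Matrix.vecMul_vecMul, Matrix.nonsing_inv_mul _ hunit, Matrix.vecMul_one]

/-! ### Lifting factorizations to étale neighbourhoods -/

/-- The étale neighbourhood given by an étale `R`-algebra `S` and a ring homomorphism `S → K` over
`b`; the `K`-algebra structure of `S` is the one induced from `R`. -/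
@[reducible]
def EtaleNbhd.ofRingHom {K R S : Type u} [Field K] [CommRing R] [Algebra K R] (b : R →ₐ[K] K)
    [CommRing S] [Algebra R S] [Algebra.Etale R S] (φ : S →+* K)
    (h : ∀ x, φ (algebraMap R S x) = b x) : EtaleNbhd b :=
  letI : Algebra K S := ((algebraMap R S).comp (algebraMap K R)).toAlgebra
  haveI : IsScalarTower K R S := IsScalarTower.of_algebraMap_eq fun _ => rfl
  { ring := S
    point := { φ with
      commutes' := fun c => by
        change φ (algebraMap R S (algebraMap K R c)) = c
        rw [h, b.commutes]
        rfl }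
    point_over := h }

/-- An étale neighbourhood of an étale neighbourhood is an étale neighbourhood. -/
@[reducible]
def EtaleNbhd.trans {K R : Type u} [Field K] [CommRing R] [Algebra K R] {b : R →ₐ[K] K}
    (U : EtaleNbhd b) (V : EtaleNbhd U.point) : EtaleNbhd b :=
  letI : Algebra R V.ring := ((algebraMap U.ring V.ring).comp (algebraMap R U.ring)).toAlgebra
  haveI : IsScalarTower R U.ring V.ring := IsScalarTower.of_algebraMap_eq fun _ => rfl
  haveI : IsScalarTower K R V.ring := IsScalarTower.of_algebraMap_eq fun x => by
    rw [IsScalarTower.algebraMap_apply K U.ring V.ring, IsScalarTower.algebraMap_apply K R U.ring]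
    rfl
  haveI : Algebra.Etale R V.ring := Algebra.Etale.comp R U.ring V.ring
  { ring := V.ring
    point := V.point
    point_over := fun x => by
      change V.point (algebraMap U.ring V.ring (algebraMap R U.ring x)) = b x
      rw [V.point_over, U.point_over] }

/-- A coprime factorization over an `R`-algebra `T` of a monic polynomial over `R` comes from an
étale `R`-algebra, namely the universal coprime factorization ring. -/
theorem exists_etale_eq_mul {R : Type u} {T : Type*} [CommRing R] [Nontrivial R] [CommRing T]
    [Nontrivial T] [Algebra R T] (P : Polynomial R) (hP : P.Monic) (f g : Polynomial T)
    (hf : f.Monic) (hg : g.Monic) (hfg : IsCoprime f g) (h : P.map (algebraMap R T) = f * g) :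
    ∃ (S : Type u) (_ : CommRing S) (_ : Algebra R S) (_ : Algebra.Etale R S) (φ : S →ₐ[R] T)
      (P₁ P₂ : Polynomial S), P₁.Monic ∧ P₂.Monic ∧ IsCoprime P₁ P₂ ∧
      P.map (algebraMap R S) = P₁ * P₂ ∧ P₁.map (φ : S →+* T) = f ∧ P₂.map (φ : S →+* T) = g := by
  have hdeg : P.natDegree = f.natDegree + g.natDegree := by
    rw [← hf.natDegree_mul hg, ← h, hP.natDegree_map]
  let p : Polynomial.MonicDegreeEq R P.natDegree := .mk P hP rfl
  obtain ⟨φ, hφ⟩ := (Polynomial.UniversalCoprimeFactorizationRing.homEquiv T f.natDegree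
    g.natDegree hdeg p).surjective ⟨(.mk f hf rfl, .mk g hg rfl), h.symm, hfg⟩
  have h₁ := Polynomial.UniversalCoprimeFactorizationRing.homEquiv_comp_fst _ f.natDegree
    g.natDegree hdeg p (AlgHom.id R _) φ
  have h₂ := Polynomial.UniversalCoprimeFactorizationRing.homEquiv_comp_snd _ f.natDegree
    g.natDegree hdeg p (AlgHom.id R _) φ
  rw [AlgHom.comp_id, hφ] at h₁ h₂
  generalize Polynomial.UniversalCoprimeFactorizationRing.homEquiv
    (Polynomial.UniversalCoprimeFactorizationRing f.natDegree g.natDegree hdeg p)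
    f.natDegree g.natDegree hdeg p (AlgHom.id R _) = q at h₁ h₂
  exact ⟨_, _, _, inferInstance, φ, q.1.1.1, q.1.2.1, q.1.1.monic, q.1.2.monic, q.2.2,
    q.2.1.symm, (congrArg Subtype.val h₁).symm, (congrArg Subtype.val h₂).symm⟩

/-- A coprime factorization of the fibre of a monic polynomial extends to an étale neighbourhood. -/
theorem exists_etaleNbhd_eq_mul {K R : Type u} [Field K] [CommRing R] [Algebra K R]
    (b : R →ₐ[K] K) (P : Polynomial R) (hP : P.Monic) (f g : Polynomial K) (hf : f.Monic)
    (hg : g.Monic) (hfg : IsCoprime f g) (h : P.map b.toRingHom = f * g) :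
    ∃ (U : EtaleNbhd b) (P₁ P₂ : Polynomial U.ring), P₁.Monic ∧ P₂.Monic ∧ IsCoprime P₁ P₂ ∧
      P.map (algebraMap R U.ring) = P₁ * P₂ ∧ P₁.map U.point.toRingHom = f ∧
      P₂.map U.point.toRingHom = g := by
  let : Algebra R K := b.toRingHom.toAlgebra
  have : Nontrivial R := b.toRingHom.domain_nontrivial
  obtain ⟨S, _, _, _, φ, P₁, P₂, h₁, h₂, h₃, h₄, h₅, h₆⟩ :=
    exists_etale_eq_mul (T := K) P hP f g hf hg hfg h
  exact ⟨EtaleNbhd.ofRingHom b φ.toRingHom fun x => φ.commutes x, P₁, P₂, h₁, h₂, h₃, h₄, h₅, h₆⟩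

/-- The version of `exists_etaleNbhd_eq_mul` with several factors. -/
theorem exists_etaleNbhd_eq_prod {K : Type u} [Field K] (k : ℕ) :
    ∀ {R : Type u} [CommRing R] [Algebra K R] (b : R →ₐ[K] K) (P : Polynomial R) (_ : P.Monic)
      (f : Fin k → Polynomial K) (_ : ∀ j, (f j).Monic)
      (_ : Pairwise fun i j => IsCoprime (f i) (f j)) (_ : P.map b.toRingHom = ∏ j, f j),
    ∃ (U : EtaleNbhd b) (Q : Fin k → Polynomial U.ring), (∀ j, (Q j).Monic) ∧
      (Pairwise fun i j => IsCoprime (Q i) (Q j)) ∧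
      P.map (algebraMap R U.ring) = ∏ j, Q j ∧ ∀ j, (Q j).map U.point.toRingHom = f j := by
  induction k with
  | zero =>
    intro R _ _ b P hP f _ _ h
    refine ⟨EtaleNbhd.ofRingHom (S := R) b b.toRingHom fun _ => rfl, Fin.elim0,
      fun j => j.elim0, fun i => i.elim0, ?_, fun j => j.elim0⟩
    have h1 : P.natDegree = 0 := by
      rw [← hP.natDegree_map b.toRingHom, h]
      simp
    rw [hP.natDegree_eq_zero.mp h1]
    simp
  | succ k ih =>
    intro R _ _ b P hP f hf hcop h
    rw [Fin.prod_univ_succ] at h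
    obtain ⟨U, P₁, P₂, hP₁, hP₂, hc, hfac, h₁, h₂⟩ := exists_etaleNbhd_eq_mul b P hP (f 0)
      (∏ j : Fin k, f j.succ) (hf 0) (Polynomial.monic_prod_of_monic _ _ fun j _ => hf _)
      (IsCoprime.prod_right fun j _ => hcop (Fin.succ_ne_zero j).symm) h
    obtain ⟨V, Q, hQ, hQc, hQp, hQf⟩ := ih U.point P₂ hP₂ (fun j => f j.succ) (fun j => hf _)
      (fun i j hij => hcop (by simpa using hij)) h₂
    have hc' : ∀ j, IsCoprime (P₁.map (algebraMap U.ring V.ring)) (Q j) := by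
      have h3 := hc.map (Polynomial.mapRingHom (algebraMap U.ring V.ring))
      simp only [Polynomial.coe_mapRingHom] at h3
      rw [hQp] at h3
      exact fun j => IsCoprime.prod_right_iff.mp h3 j (Finset.mem_univ j)
    refine ⟨U.trans V, Fin.cons (P₁.map (algebraMap U.ring V.ring)) Q, ?_, ?_, ?_, ?_⟩
    · intro j
      refine Fin.cases ?_ (fun j => ?_) j
      · exact hP₁.map _
      · exact hQ j
    · intro i j
      refine Fin.cases ?_ (fun i => ?_) i <;> refine Fin.cases ?_ (fun j => ?_) j
      · intro h; exact absurd rfl h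
      · intro _; exact hc' j
      · intro _; exact (hc' i).symm
      · intro h; exact hQc (by simpa using h)
    · rw [Fin.prod_univ_succ]
      change P.map ((algebraMap U.ring V.ring).comp (algebraMap R U.ring)) = _
      rw [← Polynomial.map_map, hfac, Polynomial.map_mul, hQp]
      rfl
    · intro j
      refine Fin.cases ?_ (fun j => ?_) j
      · change (P₁.map (algebraMap U.ring V.ring)).map V.point.toRingHom = f 0
        rw [Polynomial.map_map, ← h₁]
        congr 1
        ext x
        exact V.point_over x
      · exact hQf j

/-- The version of `exists_etaleNbhd_eq_prod` for a polynomial whose leading coefficient is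
invertible at the point. -/
theorem exists_etaleNbhd_eq_unit_mul_prod {K R : Type u} [Field K] [CommRing R] [Algebra K R]
    (b : R →ₐ[K] K) (P : Polynomial R) {d k : ℕ} (hP : P.natDegree ≤ d) (f : Fin k → Polynomial K)
    (hf : ∀ j, (f j).Monic) (hcop : Pairwise fun i j => IsCoprime (f i) (f j))
    (hd : (∏ j, f j).natDegree = d) (c : K) (hc : c ≠ 0)
    (h : P.map b.toRingHom = Polynomial.C c * ∏ j, f j) :
    ∃ (U : EtaleNbhd b) (c : U.ringˣ) (Q : Fin k → Polynomial U.ring), (∀ j, (Q j).Monic) ∧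
      (Pairwise fun i j => IsCoprime (Q i) (Q j)) ∧
      P.map (algebraMap R U.ring) = Polynomial.C (c : U.ring) * ∏ j, Q j ∧
      ∀ j, (Q j).map U.point.toRingHom = f j := by
  have hprod : (∏ j, f j).Monic := Polynomial.monic_prod_of_monic _ _ fun j _ => hf j
  have hcoeff : b (P.coeff d) = c := by
    have h1 := congrArg (fun p => Polynomial.coeff p d) h
    simp only [Polynomial.coeff_map, Polynomial.coeff_C_mul] at h1
    rw [← hd, hprod.coeff_natDegree, mul_one, hd] at h1
    exact h1
  have hunit : IsUnit (b.toRingHom (P.coeff d)) := by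
    change IsUnit (b (P.coeff d))
    rw [hcoeff]
    exact hc.isUnit
  let φ : Localization.Away (P.coeff d) →+* K := IsLocalization.Away.lift (P.coeff d) hunit
  have hφ : ∀ x, φ (algebraMap R _ x) = b x := fun x => IsLocalization.Away.lift_eq _ hunit x
  obtain ⟨U, u, hu⟩ : ∃ U : EtaleNbhd b, IsUnit (algebraMap R U.ring (P.coeff d)) :=
    ⟨EtaleNbhd.ofRingHom b φ hφ, IsLocalization.Away.algebraMap_isUnit (P.coeff d)⟩
  let P' : Polynomial U.ring := Polynomial.C (↑u⁻¹ : U.ring) * P.map (algebraMap R U.ring)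
  have hP'c : P'.coeff d = 1 := by
    simp only [P', Polynomial.coeff_C_mul, Polynomial.coeff_map, ← hu]
    exact u.inv_mul
  have hP'd : P'.natDegree ≤ d :=
    (Polynomial.natDegree_C_mul_le _ _).trans (Polynomial.natDegree_map_le.trans hP)
  have hP' : P'.Monic := Polynomial.monic_of_natDegree_le_of_coeff_eq_one d hP'd hP'c
  have hPP' : P.map (algebraMap R U.ring) = Polynomial.C (u : U.ring) * P' := by
    rw [← mul_assoc, ← Polynomial.C_mul, u.mul_inv, Polynomial.C_1, one_mul]
  have hbar : P'.map U.point.toRingHom = ∏ j, f j := by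
    have h1 : (P.map (algebraMap R U.ring)).map U.point.toRingHom = P.map b.toRingHom := by
      rw [Polynomial.map_map]
      congr 1
      ext x
      exact U.point_over x
    have h2 : U.point (u : U.ring) = c := by
      rw [hu, U.point_over, hcoeff]
    rw [hPP', Polynomial.map_mul, Polynomial.map_C, h] at h1
    have h3 : U.point.toRingHom (u : U.ring) = c := h2
    rw [h3] at h1
    exact mul_left_cancel₀ (Polynomial.C_ne_zero.mpr hc) h1
  obtain ⟨V, Q, hQ, hQc, hQp, hQf⟩ := exists_etaleNbhd_eq_prod k U.point P' hP' f hf hcop hbar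
  refine ⟨U.trans V, Units.map (algebraMap U.ring V.ring).toMonoidHom u, Q, hQ, hQc, ?_, hQf⟩
  change P.map ((algebraMap U.ring V.ring).comp (algebraMap R U.ring)) = _
  rw [← Polynomial.map_map, hPP', Polynomial.map_mul, hQp, Polynomial.map_C]
  rfl

/-! ### Linear changes of coordinates on `ℙ¹` -/

section ChangeCoord

variable {A B : Type*} [CommRing A] [CommRing B]

theorem changeCoord_X (g : GL (Fin 2) A) (i : Fin 2) :
    changeCoord g (MvPolynomial.X i) = ∑ j, MvPolynomial.C (g.val i j) * MvPolynomial.X j := by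
  simp [changeCoord]

theorem changeCoord_C (g : GL (Fin 2) A) (a : A) :
    changeCoord g (MvPolynomial.C a) = MvPolynomial.C a := by
  simp [changeCoord, MvPolynomial.algebraMap_eq]

theorem changeCoord_mul (g : GL (Fin 2) A) (P Q : MvPolynomial (Fin 2) A) :
    changeCoord g (P * Q) = changeCoord g P * changeCoord g Q := map_mul _ _ _

theorem changeCoord_pow (g : GL (Fin 2) A) (P : MvPolynomial (Fin 2) A) (n : ℕ) :
    changeCoord g (P ^ n) = changeCoord g P ^ n := map_pow _ _ _

theorem changeCoord_prod {ι : Type*} (g : GL (Fin 2) A) (s : Finset ι)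
    (P : ι → MvPolynomial (Fin 2) A) :
    changeCoord g (∏ j ∈ s, P j) = ∏ j ∈ s, changeCoord g (P j) := map_prod _ _ _

theorem changeCoord_changeCoord (g h : GL (Fin 2) A) (P : MvPolynomial (Fin 2) A) :
    changeCoord g (changeCoord h P) = changeCoord (h * g) P := by
  rw [changeCoord, changeCoord, changeCoord, ← AlgHom.comp_apply, MvPolynomial.comp_aeval]
  congr 2
  funext i
  simp only [Fin.sum_univ_two, map_add, map_mul, MvPolynomial.algHom_C, MvPolynomial.aeval_X,
    Units.val_mul, Matrix.mul_apply, MvPolynomial.algebraMap_eq]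
  ring

theorem changeCoord_one (P : MvPolynomial (Fin 2) A) : changeCoord 1 P = P := by
  have h : (fun i : Fin 2 => ∑ j : Fin 2, MvPolynomial.C ((1 : GL (Fin 2) A).val i j) *
      (MvPolynomial.X j : MvPolynomial (Fin 2) A)) = MvPolynomial.X := by
    funext i
    fin_cases i <;> simp
  rw [changeCoord, h, MvPolynomial.aeval_X_left, AlgHom.id_apply]

theorem changeCoord_inv_changeCoord (g : GL (Fin 2) A) (P : MvPolynomial (Fin 2) A) :
    changeCoord g⁻¹ (changeCoord g P) = P := by
  rw [changeCoord_changeCoord, mul_inv_cancel, changeCoord_one]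

theorem map_changeCoord (φ : A →+* B) (g : GL (Fin 2) A) (P : MvPolynomial (Fin 2) A) :
    MvPolynomial.map φ (changeCoord g P) =
      changeCoord (Matrix.GeneralLinearGroup.map φ g) (MvPolynomial.map φ P) := by
  induction P using MvPolynomial.induction_on with
  | C a => rw [changeCoord_C, MvPolynomial.map_C, changeCoord_C]
  | add p q hp hq =>
    simp only [changeCoord, map_add] at hp hq ⊢
    rw [hp, hq]
  | mul_X p i hp =>
    rw [changeCoord_mul, map_mul, map_mul, changeCoord_mul, hp, MvPolynomial.map_X,
      changeCoord_X, changeCoord_X]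
    simp

theorem isHomogeneous_changeCoord (g : GL (Fin 2) A) {P : MvPolynomial (Fin 2) A} {n : ℕ}
    (hP : P.IsHomogeneous n) : (changeCoord g P).IsHomogeneous n := by
  have h := hP.aeval (fun i : Fin 2 => ∑ j : Fin 2, MvPolynomial.C (g.val i j) *
    (MvPolynomial.X j : MvPolynomial (Fin 2) A)) (n := 1) fun i =>
      MvPolynomial.IsHomogeneous.sum _ _ _ fun j _ => by
        simpa using (MvPolynomial.isHomogeneous_C (Fin 2) (g.val i j)).mul
          (MvPolynomial.isHomogeneous_X A j)
  rwa [one_mul] at h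

theorem DisjointZeros.changeCoord {P Q : MvPolynomial (Fin 2) A} (h : DisjointZeros P Q)
    (g : GL (Fin 2) A) : DisjointZeros (changeCoord g P) (changeCoord g Q) := by
  let φ : MvPolynomial (Fin 2) A →ₐ[A] MvPolynomial (Fin 2) A := MvPolynomial.aeval
    (fun i : Fin 2 => ∑ j : Fin 2, MvPolynomial.C (g.val i j) * MvPolynomial.X j)
  have hφ : ∀ P, PointLine.changeCoord g P = φ P := fun _ => rfl
  have h1 : ∀ i, φ (MvPolynomial.X i) ∈ (Ideal.span {φ P, φ Q}).radical := by
    intro i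
    have h2 : (MvPolynomial.X i : MvPolynomial (Fin 2) A) ∈ (Ideal.span {P, Q}).radical := by
      apply h
      apply Ideal.subset_span
      fin_cases i <;> simp
    obtain ⟨n, hn⟩ := h2
    refine ⟨n, ?_⟩
    rw [← map_pow]
    have h3 := Ideal.mem_map_of_mem φ hn
    rwa [Ideal.map_span, Set.image_pair] at h3
  have h4 : ∀ i, (MvPolynomial.X i : MvPolynomial (Fin 2) A) ∈
      (Ideal.span {φ P, φ Q}).radical := by
    intro i
    have h5 : (MvPolynomial.X i : MvPolynomial (Fin 2) A) =
        ∑ j, MvPolynomial.C (g⁻¹.val i j) * φ (MvPolynomial.X j) := by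
      have h6 := changeCoord_changeCoord g g⁻¹ (MvPolynomial.X i)
      rw [inv_mul_cancel, changeCoord_one, changeCoord_X, hφ, map_sum] at h6
      rw [← h6]
      refine Finset.sum_congr rfl fun j _ => ?_
      rw [map_mul, MvPolynomial.algHom_C, MvPolynomial.algebraMap_eq]
    rw [h5]
    exact Ideal.sum_mem _ fun j _ => Ideal.mul_mem_left _ _ (h1 j)
  rw [DisjointZeros, Ideal.span_le]
  rintro x (rfl | rfl)
  · exact h4 0
  · exact h4 1

end ChangeCoord

/-! ### Homogenizations of monic polynomials -/

section Homogenize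

variable {A : Type*} [CommRing A]

/-- The homogenization of a monic polynomial is congruent to a power of `s` modulo `t`. -/
theorem homogenize_sub_X_pow_mem {P : Polynomial A} (hP : P.Monic) {m : ℕ} (hm : P.natDegree = m) :
    P.homogenize m - MvPolynomial.X 0 ^ m ∈
      Ideal.span {(MvPolynomial.X 1 : MvPolynomial (Fin 2) A)} := by
  nontriviality A
  rw [Ideal.mem_span_singleton]
  rcases Nat.eq_zero_or_pos m with rfl | hpos
  · rw [hP.natDegree_eq_zero.mp hm]
    simp
  · obtain ⟨n, rfl⟩ : ∃ n, m = n + 1 := ⟨m - 1, by omega⟩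
    have h1 : P.homogenize (n + 1) - MvPolynomial.X 0 ^ (n + 1) =
        (P - Polynomial.X ^ (n + 1)).homogenize (n + 1) := by
      rw [Polynomial.homogenize_sub, Polynomial.homogenize_X_pow le_rfl]
      simp
    have h2 : (P - Polynomial.X ^ (n + 1)).natDegree ≤ n := by
      refine Polynomial.natDegree_le_iff_coeff_eq_zero.mpr fun N hN => ?_
      rw [Polynomial.coeff_sub, Polynomial.coeff_X_pow]
      split_ifs with hN'
      · rw [hN', ← hm, hP.coeff_natDegree, sub_self]
      · rw [Polynomial.coeff_eq_zero_of_natDegree_lt (by omega), sub_zero]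
    have h3 := Polynomial.homogenize_mul (P - Polynomial.X ^ (n + 1)) 1 h2
      (n := 1) (by simp)
    rw [mul_one] at h3
    rw [h1, h3, Polynomial.homogenize_one, pow_one]
    exact dvd_mul_left _ _

/-- Coprime polynomials, one of which is monic, have homogenizations without common zero. -/
theorem disjointZeros_homogenize {P Q : Polynomial A} (hP : P.Monic) {m n : ℕ}
    (hm : P.natDegree = m) (hn : Q.natDegree ≤ n) (h : IsCoprime P Q) :
    DisjointZeros (P.homogenize m) (Q.homogenize n) := by
  obtain ⟨a, c, hac⟩ := h
  let I := Ideal.span {P.homogenize m, Q.homogenize n}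
  have hPI : P.homogenize m ∈ I := Ideal.subset_span (by simp)
  have hQI : Q.homogenize n ∈ I := Ideal.subset_span (by simp)
  have h1 : (MvPolynomial.X 1 : MvPolynomial (Fin 2) A) ∈ I.radical := by
    refine ⟨(a.natDegree + c.natDegree + n) + m, ?_⟩
    have h2 := Polynomial.homogenize_mul a P (m := a.natDegree + c.natDegree + n) (n := m)
      (by omega) hm.le
    have h3 := Polynomial.homogenize_mul c Q (m := a.natDegree + c.natDegree + m) (n := n)
      (by omega) hn
    rw [show a.natDegree + c.natDegree + m + n = a.natDegree + c.natDegree + n + m by omega] at h3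
    rw [← Polynomial.homogenize_one, ← hac, Polynomial.homogenize_add, h2, h3]
    exact I.add_mem (I.mul_mem_left _ hPI) (I.mul_mem_left _ hQI)
  have h0 : (MvPolynomial.X 0 : MvPolynomial (Fin 2) A) ∈ I.radical := by
    have h4 : (MvPolynomial.X 0 : MvPolynomial (Fin 2) A) ^ m ∈ I.radical := by
      rw [← sub_sub_cancel (P.homogenize m) (MvPolynomial.X 0 ^ m)]
      refine I.radical.sub_mem (Ideal.le_radical hPI) ?_
      refine (Ideal.span_le.mpr ?_) (homogenize_sub_X_pow_mem hP hm)
      rintro x rfl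
      exact h1
    rw [← Ideal.radical_idem]
    exact ⟨m, h4⟩
  rw [DisjointZeros, Ideal.span_le]
  rintro x (rfl | rfl)
  · exact h0
  · exact h1

/-- The translation `[s : t] ↦ [s + c t : t]` of `ℙ¹`. -/
def shift (c : A) : GL (Fin 2) A :=
  ⟨!![1, c; 0, 1], !![1, -c; 0, 1], by simp [Matrix.one_fin_two], by simp [Matrix.one_fin_two]⟩

theorem changeCoord_shift_homogenize (c : A) (P : Polynomial A) {m : ℕ} (hm : P.natDegree ≤ m) :
    changeCoord (shift c) (P.homogenize m) = (Polynomial.taylor c P).homogenize m := by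
  refine (Polynomial.homogenize_eq_of_isHomogeneous
    (isHomogeneous_changeCoord _ (Polynomial.isHomogeneous_homogenize P)) ?_).symm
  rw [changeCoord, ← AlgHom.comp_apply, MvPolynomial.comp_aeval,
    Polynomial.aeval_homogenize_of_eq_one hm _ (by simp [shift])]
  rw [Polynomial.taylor_apply, Polynomial.comp_eq_aeval]
  congr 2
  simp [shift]

theorem taylor_coeff_pred {P : Polynomial A} (hP : P.Monic) {n : ℕ} (hn : P.natDegree = n + 1)
    (c : A) : (Polynomial.taylor c P).coeff n = P.coeff n + (n + 1) * c := by
  have h : Polynomial.hasseDeriv n P =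
      Polynomial.C (P.coeff n) + Polynomial.C ((n : A) + 1) * Polynomial.X := by
    ext k
    rw [Polynomial.hasseDeriv_coeff]
    rcases k with _ | _ | k
    · simp
    · have h1 : P.coeff (1 + n) = 1 := by
        rw [add_comm, ← hn, hP.coeff_natDegree]
      have h2 : (1 + n).choose n = n + 1 := by
        rw [add_comm, Nat.choose_succ_self_right]
      simp [h1, h2]
    · rw [Polynomial.coeff_eq_zero_of_natDegree_lt (by omega)]
      simp [Polynomial.coeff_one]
  rw [Polynomial.taylor_coeff, h]
  simp

theorem unfolding_eq_homogenize {P : Polynomial A} (hP : P.Monic) {m : ℕ} (hpos : 0 < m)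
    (hm : P.natDegree = m) (h : P.coeff (m - 1) = 0) :
    unfolding m (fun i => P.coeff i) = P.homogenize m := by
  have h1 : P = Polynomial.X ^ m +
      ∑ i : Fin (m - 1), Polynomial.C (P.coeff i) * Polynomial.X ^ (i : ℕ) := by
    conv_lhs => rw [hP.as_sum, hm]
    congr 1
    obtain ⟨n, rfl⟩ : ∃ n, m = n + 1 := ⟨m - 1, by omega⟩
    rw [Finset.sum_range_succ]
    simp only [Nat.add_sub_cancel] at h ⊢
    rw [h, Polynomial.C_0, zero_mul, add_zero, Finset.sum_range]
    rfl
  conv_rhs => rw [h1]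
  rw [Polynomial.homogenize_add, Polynomial.homogenize_X_pow le_rfl,
    Polynomial.homogenize_finsetSum, unfolding]
  congr 1
  · simp
  · refine Finset.sum_congr rfl fun i _ => ?_
    rw [Polynomial.homogenize_C_mul, Polynomial.homogenize_X_pow (by omega), mul_assoc]

end Homogenize

/-- The shift killing the subleading coefficient of a monic polynomial of degree `m` over a
`ℚ`-algebra; here `K` is a field of characteristic zero below `A`. -/
def tschirnhausShift (K : Type*) {A : Type*} [Field K] [CommRing A] [Algebra K A] (m : ℕ)
    (P : Polynomial A) : A :=
  -(algebraMap K A (m : K)⁻¹ * P.coeff (m - 1))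

theorem coeff_taylor_tschirnhausShift {K A : Type*} [Field K] [CharZero K] [CommRing A]
    [Algebra K A] {P : Polynomial A} (hP : P.Monic) {m : ℕ} (hpos : 0 < m)
    (hm : P.natDegree = m) :
    (Polynomial.taylor (tschirnhausShift K m P) P).coeff (m - 1) = 0 := by
  obtain ⟨n, rfl⟩ : ∃ n, m = n + 1 := ⟨m - 1, by omega⟩
  rw [Nat.add_sub_cancel, taylor_coeff_pred hP hm, tschirnhausShift, Nat.add_sub_cancel]
  have h1 : ((n : A) + 1) * algebraMap K A ((n + 1 : ℕ) : K)⁻¹ = 1 := by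
    have h2 : ((n : A) + 1) = algebraMap K A ((n + 1 : ℕ) : K) := by simp
    rw [h2, ← map_mul, mul_inv_cancel₀ (Nat.cast_ne_zero.mpr (Nat.succ_ne_zero n)), map_one]
  linear_combination -P.coeff n * h1

/-! ### Existence of unfolding maps -/

theorem map_aeval_X_one {A B : Type*} [CommRing A] [CommRing B] (φ : A →+* B)
    (q : MvPolynomial (Fin 2) A) :
    (MvPolynomial.aeval ![Polynomial.X, 1] q : Polynomial A).map φ =
      MvPolynomial.aeval ![Polynomial.X, 1] (MvPolynomial.map φ q) := by
  induction q using MvPolynomial.induction_on with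
  | C a => simp
  | add p q hp hq => simp only [map_add, Polynomial.map_add, hp, hq]
  | mul_X p i hp =>
    rw [map_mul, Polynomial.map_mul, hp, map_mul, map_mul]
    congr 1
    fin_cases i <;> simp

/-- A family of forms whose fibre is `∏_j (s - α_j t)^(m_j)` in suitable coordinates has an
unfolding map: the factorization of the fibre lifts to an étale neighbourhood, and each factor is
brought to the form `unfolding (m j) a` by a Tschirnhaus shift. -/
theorem exists_isUnfoldingMap {K R : Type u} [Field K] [CharZero K] [CommRing R] [Algebra K R]
    (b : R →ₐ[K] K) (Z : MvPolynomial (Fin 2) R) {k : ℕ} (m : Fin k → ℕ) (hm : ∀ j, 0 < m j)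
    (hZ : Z.IsHomogeneous (∑ j, m j)) (α : Fin k → K) (hα : Function.Injective α) (c : K)
    (hc : c ≠ 0) (g : GL (Fin 2) K)
    (h : changeCoord g (MvPolynomial.map b.toRingHom Z) = MvPolynomial.C c *
      ∏ j, (MvPolynomial.X 0 - MvPolynomial.C (α j) * MvPolynomial.X 1) ^ m j) :
    ∃ (U : EtaleNbhd b) (μ : UnfoldingBase K m →ₐ[K] U.ring), IsUnfoldingMap Z m U μ := by
  let gR := Matrix.GeneralLinearGroup.map (algebraMap K R) g
  let P : Polynomial R := MvPolynomial.aeval ![Polynomial.X, 1] (changeCoord gR Z)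
  have hPZ : P.homogenize (∑ j, m j) = changeCoord gR Z :=
    Polynomial.homogenize_eq_of_isHomogeneous (isHomogeneous_changeCoord gR hZ) rfl
  have hbg : Matrix.GeneralLinearGroup.map b.toRingHom gR = g := by
    ext i j
    exact b.commutes _
  let f : Fin k → Polynomial K := fun j => (Polynomial.X - Polynomial.C (α j)) ^ m j
  have hf : ∀ j, (f j).Monic := fun j => (Polynomial.monic_X_sub_C _).pow _
  have hfd : ∀ j, (f j).natDegree = m j := fun j => by
    simp only [f, Polynomial.natDegree_pow, Polynomial.natDegree_X_sub_C, mul_one]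
  have hP : P.map b.toRingHom = Polynomial.C c * ∏ j, f j := by
    rw [map_aeval_X_one, map_changeCoord, hbg, h]
    simp [f]
  have hPd : P.natDegree ≤ ∑ j, m j := by
    have h1 := MvPolynomial.aeval_natDegree_le (changeCoord gR Z)
      (isHomogeneous_changeCoord gR hZ).totalDegree_le ![Polynomial.X, 1] (n := 1)
      (by intro i; fin_cases i <;> simp [Polynomial.natDegree_X_le])
    rwa [mul_one] at h1
  have hcop : Pairwise fun i j => IsCoprime (f i) (f j) := fun i j hij =>
    IsCoprime.pow (Polynomial.isCoprime_X_sub_C_of_isUnit_sub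
      (sub_ne_zero.mpr fun h => hij (hα h)).isUnit)
  have hd : (∏ j, f j).natDegree = ∑ j, m j := by
    rw [Polynomial.natDegree_prod_of_monic _ _ fun j _ => hf j]
    exact Finset.sum_congr rfl fun j _ => hfd j
  obtain ⟨U, u, Q, hQ, hQc, hQp, hQf⟩ :=
    exists_etaleNbhd_eq_unit_mul_prod b P hPd f hf hcop hd c hc hP
  have hUn : Nontrivial U.ring := U.point.toRingHom.domain_nontrivial
  have hQd : ∀ j, (Q j).natDegree = m j := fun j => by
    rw [← (hQ j).natDegree_map U.point.toRingHom, hQf, hfd]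
  let gU := Matrix.GeneralLinearGroup.map (algebraMap R U.ring) gR
  -- the Tschirnhaus normal form of the `j`-th factor
  let T : Fin k → Polynomial U.ring := fun j =>
    Polynomial.taylor (tschirnhausShift K (m j) (Q j)) (Q j)
  have hT : ∀ j, (T j).Monic := fun j => by
    rw [Polynomial.Monic, Polynomial.leadingCoeff_taylor, hQ j]
  have hTd : ∀ j, (T j).natDegree = m j := fun j => by
    rw [Polynomial.natDegree_taylor, hQd]
  have hT0 : ∀ j, (T j).coeff (m j - 1) = 0 := fun j =>
    coeff_taylor_tschirnhausShift (hQ j) (hm j) (hQd j)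
  have hTp : ∀ j, (T j).map U.point.toRingHom = Polynomial.X ^ m j := by
    intro j
    have h1 : U.point.toRingHom (tschirnhausShift K (m j) (Q j)) = α j := by
      have h2 : (f j).coeff (m j - 1) = -(m j * α j) := by
        obtain ⟨n, hn⟩ : ∃ n, m j = n + 1 := ⟨m j - 1, by have := hm j; omega⟩
        have h3 := taylor_coeff_pred (hf j) ((hfd j).trans hn) (α j)
        have h4 : Polynomial.taylor (α j) (f j) = Polynomial.X ^ m j := by
          simp [f, Polynomial.taylor_pow]
        rw [h4, hn, Polynomial.coeff_X_pow, if_neg (by omega)] at h3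
        rw [hn, Nat.add_sub_cancel]
        push_cast
        linear_combination -h3
      have h5 : U.point.toRingHom ((Q j).coeff (m j - 1)) = -(m j * α j) := by
        rw [← Polynomial.coeff_map, hQf, h2]
      have h6 : U.point.toRingHom (algebraMap K U.ring (m j : K)⁻¹) = (m j : K)⁻¹ :=
        U.point.commutes _
      have h7 : (m j : K) ≠ 0 := Nat.cast_ne_zero.mpr (hm j).ne'
      rw [tschirnhausShift, map_neg, map_mul, h5, h6]
      field_simp
    simp only [T]
    rw [Polynomial.taylor_apply, Polynomial.map_comp, hQf]
    simp only [Polynomial.map_add, Polynomial.map_X, Polynomial.map_C, h1, f]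
    simp
  refine ⟨U, MvPolynomial.aeval fun i : Σ j : Fin k, Fin (m j - 1) => (T i.1).coeff i.2, ?_,
    fun j => changeCoord gU⁻¹ ((Q j).homogenize (m j)), ⟨u, ?_⟩, ?_, ?_⟩
  · refine MvPolynomial.algHom_ext fun i => ?_
    rw [AlgHom.comp_apply, MvPolynomial.aeval_X, unfoldingOrigin, MvPolynomial.aeval_X]
    have h1 := Polynomial.coeff_map U.point.toRingHom (p := T i.1) i.2
    rw [hTp, Polynomial.coeff_X_pow, if_neg (by omega)] at h1
    exact h1.symm
  · rw [← changeCoord_prod, ← Polynomial.homogenize_finsetProd fun j _ => (hQd j).le,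
      ← changeCoord_C gU⁻¹ (u : U.ring), ← changeCoord_mul, ← Polynomial.homogenize_C_mul, ← hQp,
      Polynomial.homogenize_map, hPZ, map_changeCoord, changeCoord_inv_changeCoord]
  · intro i j hij
    exact (disjointZeros_homogenize (hQ i) (hQd i) (hQd j).le (hQc hij)).changeCoord _
  · intro j
    refine ⟨gU * shift (tschirnhausShift K (m j) (Q j)), 1, ?_⟩
    rw [← changeCoord_changeCoord, changeCoord_changeCoord gU, inv_mul_cancel, changeCoord_one,
      changeCoord_shift_homogenize _ _ (hQd j).le, Units.val_one, MvPolynomial.C_1, one_mul]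
    simp only [MvPolynomial.aeval_X]
    exact (unfolding_eq_homogenize (hT j) (hm j) (hTd j) (hT0 j)).symm

/-! ### Images of hypersurfaces are not dense -/

/-- Modulo an irreducible polynomial in `n` variables, `n` or more polynomials are algebraically
dependent, as the residue field has transcendence degree less than `n`. -/
theorem exists_ne_zero_dvd_aeval {K σ τ : Type*} [Field K] [Finite σ] (ι : σ ↪ τ)
    (Ψ : τ → MvPolynomial σ K) (Δ : MvPolynomial σ K) (hΔ : Prime Δ) :
    ∃ Φ : MvPolynomial τ K, Φ ≠ 0 ∧ Δ ∣ MvPolynomial.aeval Ψ Φ := by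
  let I := Ideal.span {Δ}
  have hI : I.IsPrime := (Ideal.span_singleton_prime hΔ.ne_zero).mpr hΔ
  let π : MvPolynomial σ K →ₐ[K] MvPolynomial σ K ⧸ I := Ideal.Quotient.mkₐ K I
  have hdep : ¬ AlgebraicIndependent K (fun t => π (Ψ t)) := by
    intro hind
    have h1 := (hind.comp ι ι.injective).lift_cardinalMk_le_trdeg
    let x : σ → MvPolynomial σ K ⧸ I := fun i => π (MvPolynomial.X i)
    have h2 : MvPolynomial.aeval x = π := by
      refine MvPolynomial.algHom_ext fun i => ?_
      rw [MvPolynomial.aeval_X]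
    have hadj : Algebra.adjoin K (Set.range x) = ⊤ := by
      rw [Algebra.adjoin_range_eq_range_aeval, AlgHom.range_eq_top, h2]
      exact Ideal.Quotient.mkₐ_surjective K I
    have halg : Algebra.IsAlgebraic (Algebra.adjoin K (Set.range x)) (MvPolynomial σ K ⧸ I) := by
      refine ⟨fun a => ?_⟩
      have ha : a ∈ Algebra.adjoin K (Set.range x) := by rw [hadj]; trivial
      exact isAlgebraic_algebraMap (⟨a, ha⟩ : Algebra.adjoin K (Set.range x))
    have h3 := Algebra.IsAlgebraic.isTranscendenceBasis_of_lift_le_trdeg_of_finite K x h1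
    have h4 : MvPolynomial.aeval x Δ = MvPolynomial.aeval x (0 : MvPolynomial σ K) := by
      rw [h2, map_zero]
      exact Ideal.Quotient.eq_zero_iff_mem.mpr (Ideal.mem_span_singleton_self Δ)
    exact hΔ.ne_zero (h3.1 h4)
  rw [algebraicIndependent_iff] at hdep
  push Not at hdep
  obtain ⟨Φ, h0, hne⟩ := hdep
  refine ⟨Φ, hne, ?_⟩
  rw [← Ideal.mem_span_singleton, ← Ideal.Quotient.eq_zero_iff_mem]
  have h5 : MvPolynomial.aeval (fun t => π (Ψ t)) Φ = π (MvPolynomial.aeval Ψ Φ) := by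
    rw [← AlgHom.comp_apply, MvPolynomial.comp_aeval]
  rwa [h5] at h0

theorem eval_aeval_eq {K σ τ : Type*} [CommRing K] (θ : σ → K) (Ψ : τ → MvPolynomial σ K)
    (Φ : MvPolynomial τ K) : MvPolynomial.eval θ (MvPolynomial.aeval Ψ Φ) =
      MvPolynomial.eval (fun t => MvPolynomial.eval θ (Ψ t)) Φ := by
  induction Φ using MvPolynomial.induction_on with
  | C a => simp
  | add p q hp hq => simp only [map_add, hp, hq]
  | mul_X p i hp => simp only [map_mul, hp, MvPolynomial.aeval_X, MvPolynomial.eval_X]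

/-- The image of a hypersurface `Δ = 0` of `𝔸^σ` under a polynomial map to an affine space of at
least the same dimension lies in a hypersurface `Φ = 0`. -/
theorem exists_ne_zero_eval_eq_zero {K σ τ : Type*} [Field K] [Finite σ] (ι : σ ↪ τ)
    (Ψ : τ → MvPolynomial σ K) (Δ : MvPolynomial σ K) (hΔ : Δ ≠ 0) :
    ∃ Φ : MvPolynomial τ K, Φ ≠ 0 ∧ ∀ θ : σ → K, MvPolynomial.eval θ Δ = 0 →
      MvPolynomial.eval (fun t => MvPolynomial.eval θ (Ψ t)) Φ = 0 := by
  induction Δ using UniqueFactorizationMonoid.induction_on_prime with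
  | h₁ => exact absurd rfl hΔ
  | h₂ x hx =>
    refine ⟨1, one_ne_zero, fun θ h => ?_⟩
    exact absurd h (hx.map (MvPolynomial.eval θ)).ne_zero
  | h₃ a p ha hp ih =>
    obtain ⟨Φ, hΦ, h⟩ := ih ha
    obtain ⟨Φ', hΦ', h'⟩ := exists_ne_zero_dvd_aeval ι Ψ p hp
    refine ⟨Φ * Φ', mul_ne_zero hΦ hΦ', fun θ hθ => ?_⟩
    rw [map_mul, mul_eq_zero] at hθ ⊢
    rcases hθ with hθ | hθ
    · right
      obtain ⟨q, hq⟩ := h'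
      have h1 : MvPolynomial.eval θ (MvPolynomial.aeval Ψ Φ') =
          MvPolynomial.eval (fun t => MvPolynomial.eval θ (Ψ t)) Φ' := eval_aeval_eq _ _ _
      rw [← h1, hq, map_mul, hθ, zero_mul]
    · left
      exact h θ hθ

theorem eval_smul_of_isHomogeneous {K τ : Type*} [CommRing K] {Φ : MvPolynomial τ K} {n : ℕ}
    (hΦ : Φ.IsHomogeneous n) (a : K) (x : τ → K) :
    MvPolynomial.eval (a • x) Φ = a ^ n * MvPolynomial.eval x Φ := by
  rw [MvPolynomial.eval_eq, MvPolynomial.eval_eq, Finset.mul_sum]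
  refine Finset.sum_congr rfl fun d hd => ?_
  have h1 : ∑ i ∈ d.support, d i = n := by
    have h2 := hΦ (MvPolynomial.mem_support_iff.mp hd)
    rw [Finsupp.weight_apply] at h2
    simpa [Finsupp.sum] using h2
  simp only [Pi.smul_apply, smul_eq_mul, mul_pow, Finset.prod_mul_distrib]
  rw [Finset.prod_pow_eq_pow_sum, h1]
  ring

/-- If a nonzero polynomial vanishes on a cone, so does each of its homogeneous components; one of
them is nonzero. -/
theorem exists_isHomogeneous_of_cone {K τ : Type*} [Field K] [Infinite K] (S : Set (τ → K))
    (hS : ∀ x ∈ S, ∀ a : K, a ≠ 0 → a • x ∈ S) (Φ : MvPolynomial τ K) (hΦ : Φ ≠ 0)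
    (h : ∀ x ∈ S, MvPolynomial.eval x Φ = 0) :
    ∃ (n : ℕ) (Φ' : MvPolynomial τ K), Φ' ≠ 0 ∧ Φ'.IsHomogeneous n ∧
      ∀ x ∈ S, MvPolynomial.eval x Φ' = 0 := by
  obtain ⟨n, hn⟩ : ∃ n, MvPolynomial.homogeneousComponent n Φ ≠ 0 := by
    by_contra! h0
    apply hΦ
    rw [← MvPolynomial.sum_homogeneousComponent Φ]
    exact Finset.sum_eq_zero fun i _ => h0 i
  refine ⟨n, _, hn, MvPolynomial.homogeneousComponent_isHomogeneous n Φ, fun x hx => ?_⟩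
  let p : Polynomial K := ∑ i ∈ Finset.range (Φ.totalDegree + 1),
    Polynomial.C (MvPolynomial.eval x (MvPolynomial.homogeneousComponent i Φ)) * Polynomial.X ^ i
  have hp : ∀ a : K, p.eval a = MvPolynomial.eval (a • x) Φ := by
    intro a
    conv_rhs => rw [← MvPolynomial.sum_homogeneousComponent Φ, map_sum]
    simp only [p, Polynomial.eval_finsetSum]
    refine Finset.sum_congr rfl fun i _ => ?_
    rw [eval_smul_of_isHomogeneous (MvPolynomial.homogeneousComponent_isHomogeneous i Φ)]
    rw [Polynomial.eval_mul, Polynomial.eval_C, Polynomial.eval_pow, Polynomial.eval_X, mul_comm]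
  have hp0 : p = 0 := by
    refine Polynomial.eq_zero_of_infinite_isRoot p ?_
    refine Set.Infinite.mono (s := {0}ᶜ) (fun a ha => ?_) (Set.finite_singleton 0).infinite_compl
    change p.eval a = 0
    rw [hp]
    exact h _ (hS x hx a ha)
  rcases lt_or_ge n (Φ.totalDegree + 1) with hlt | hge
  · have h3 := congrArg (fun q => Polynomial.coeff q n) hp0
    simpa [p, Polynomial.finsetSum_coeff, hlt] using h3
  · rw [MvPolynomial.homogeneousComponent_eq_zero _ _ (by omega), map_zero]

/-! ### The first-order condition along a fixed line -/

section Slope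

variable {A B : Type*} [CommRing A] [CommRing B] {q : ℕ}

/-- The dehomogenized restriction to the line `y = 0` of the derivative of `F` in the direction of
the `j`-th transverse coordinate `y_j`. -/
def slope (F : MvPolynomial (Fin 2 ⊕ Fin q) A) (j : Fin q) : Polynomial A :=
  MvPolynomial.aeval (Sum.elim ![Polynomial.X, 1] 0) (MvPolynomial.pderiv (Sum.inr j) F)

/-- For the `i`-th homogeneous coordinate of the line and the `j`-th transverse coordinate, the
first-order change of the restriction of `F` when the line moves in the `(i, j)`-th coordinate
direction of the chart of the Grassmannian. -/
def variation (F : MvPolynomial (Fin 2 ⊕ Fin q) A) (a : Fin 2 × Fin q) : Polynomial A :=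
  ![Polynomial.X, 1] a.1 * slope F a.2

/-- The polynomial `∏_j (z - α_j)^(m_j - 1)`; it divides every first-order change of
`∏_j (z - α_j)^(m_j)` that preserves the multiplicities. -/
def ramification {k : ℕ} (m : Fin k → ℕ) (α : Fin k → A) : Polynomial A :=
  ∏ j, (Polynomial.X - Polynomial.C (α j)) ^ (m j - 1)

theorem monic_ramification {k : ℕ} (m : Fin k → ℕ) (α : Fin k → A) : (ramification m α).Monic :=
  Polynomial.monic_prod_of_monic _ _ fun _ _ => (Polynomial.monic_X_sub_C _).pow _

theorem natDegree_ramification [Nontrivial A] {k : ℕ} (m : Fin k → ℕ) (α : Fin k → A) :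
    (ramification m α).natDegree = ∑ j, (m j - 1) := by
  rw [ramification, Polynomial.natDegree_prod_of_monic _ _ fun _ _ =>
    (Polynomial.monic_X_sub_C _).pow _]
  refine Finset.sum_congr rfl fun j _ => ?_
  rw [(Polynomial.monic_X_sub_C _).natDegree_pow, Polynomial.natDegree_X_sub_C, mul_one]

theorem map_ramification (φ : A →+* B) {k : ℕ} (m : Fin k → ℕ) (α : Fin k → A) :
    (ramification m α).map φ = ramification m (φ ∘ α) := by
  simp [ramification, Polynomial.map_prod]

theorem map_slope (φ : A →+* B) (F : MvPolynomial (Fin 2 ⊕ Fin q) A) (j : Fin q) :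
    (slope F j).map φ = slope (MvPolynomial.map φ F) j := by
  rw [slope, slope, MvPolynomial.pderiv_map]
  generalize MvPolynomial.pderiv (Sum.inr j) F = G
  induction G using MvPolynomial.induction_on with
  | C a => simp
  | add p q hp hq => simp only [map_add, Polynomial.map_add, hp, hq]
  | mul_X p i hp =>
    rw [map_mul, Polynomial.map_mul, hp, map_mul, map_mul]
    congr 1
    rcases i with i | i
    · fin_cases i <;> simp
    · simp

theorem map_variation (φ : A →+* B) (F : MvPolynomial (Fin 2 ⊕ Fin q) A) (a : Fin 2 × Fin q) :
    (variation F a).map φ = variation (MvPolynomial.map φ F) a := by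
  obtain ⟨i, j⟩ := a
  rw [variation, variation, Polynomial.map_mul, map_slope]
  congr 1
  fin_cases i <;> simp

/-- The matrix of the `variation`s modulo `ramification m α`, in the basis `1, z, …, z^(2q-1)`. -/
def variationMatrix (F : MvPolynomial (Fin 2 ⊕ Fin q) A) {k : ℕ} (m : Fin k → ℕ) (α : Fin k → A) :
    Matrix (Fin 2 × Fin q) (Fin 2 × Fin q) A :=
  fun a b => (variation F a %ₘ ramification m α).coeff (finProdFinEquiv b)

theorem map_variationMatrix (φ : A →+* B) (F : MvPolynomial (Fin 2 ⊕ Fin q) A) {k : ℕ}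
    (m : Fin k → ℕ) (α : Fin k → A) :
    (variationMatrix F m α).map φ = variationMatrix (MvPolynomial.map φ F) m (φ ∘ α) := by
  ext a b
  rw [Matrix.map_apply, variationMatrix, variationMatrix, ← Polynomial.coeff_map,
    Polynomial.map_modByMonic φ (monic_ramification m α), map_variation, map_ramification]

/-- The determinant of the matrix vanishes exactly when a nonzero combination of the `variation`s
is divisible by `ramification m α`. -/
theorem det_variationMatrix_eq_zero_iff {K : Type*} [Field K] (F : MvPolynomial (Fin 2 ⊕ Fin q) K)
    {k : ℕ} (m : Fin k → ℕ) (hm : ∑ j, (m j - 1) = 2 * q) (α : Fin k → K) :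
    (variationMatrix F m α).det = 0 ↔
      ∃ v : Fin 2 × Fin q → K, v ≠ 0 ∧
        ramification m α ∣ ∑ a, Polynomial.C (v a) * variation F a := by
  rw [← Matrix.exists_vecMul_eq_zero_iff]
  refine exists_congr fun v => and_congr_right fun _ => ?_
  have hg := monic_ramification m α
  rw [← Polynomial.modByMonic_eq_zero_iff_dvd hg]
  have h1 : (∑ a, Polynomial.C (v a) * variation F a) %ₘ ramification m α =
      ∑ a, Polynomial.C (v a) * (variation F a %ₘ ramification m α) := by
    refine (map_sum (Polynomial.modByMonicHom (ramification m α))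
      (fun a => Polynomial.C (v a) * variation F a) Finset.univ).trans
      (Finset.sum_congr rfl fun a _ => ?_)
    simp only [← Polynomial.smul_eq_C_mul]
    exact map_smul (Polynomial.modByMonicHom (ramification m α)) _ _
  have h2 : ∀ b, Matrix.vecMul v (variationMatrix F m α) b =
      ((∑ a, Polynomial.C (v a) * variation F a) %ₘ ramification m α).coeff
        (finProdFinEquiv b) := by
    intro b
    rw [h1, Polynomial.finsetSum_coeff, Matrix.vecMul, dotProduct]
    exact Finset.sum_congr rfl fun a _ => (Polynomial.coeff_C_mul _).symm
  constructor
  · intro h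
    ext n
    rw [Polynomial.coeff_zero]
    rcases lt_or_ge n (2 * q) with hn | hn
    · have h3 := h2 (finProdFinEquiv.symm ⟨n, hn⟩)
      rw [h, Equiv.apply_symm_apply] at h3
      exact h3.symm
    · refine Polynomial.coeff_eq_zero_of_degree_lt
        ((Polynomial.degree_modByMonic_lt _ hg).trans_le ?_)
      rw [Polynomial.degree_eq_natDegree hg.ne_zero, natDegree_ramification, hm]
      exact_mod_cast hn
  · intro h
    funext b
    rw [h2, h]
    rfl

/-- The restriction of `F` to the line `y = 0`, as a form in the same coordinates. -/
def restrictLine (F : MvPolynomial (Fin 2 ⊕ Fin q) A) : MvPolynomial (Fin 2 ⊕ Fin q) A :=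
  MvPolynomial.aeval (Sum.elim (fun i => MvPolynomial.X (Sum.inl i)) 0) F

/-- The form `c ∏_j (s - α_j t)^(m_j)` in the coordinates of the line. -/
def lineForm {k : ℕ} (m : Fin k → ℕ) (α : Fin k → A) (c : A) :
    MvPolynomial (Fin 2 ⊕ Fin q) A :=
  MvPolynomial.C c * ∏ j, (MvPolynomial.X (Sum.inl 0) -
    MvPolynomial.C (α j) * MvPolynomial.X (Sum.inl 1)) ^ m j

/-- The condition on `F`, in coordinates `y` in which the line is `y = 0`, that the restriction of
`F` to the line is `c ∏_j (s - α_j t)^(m_j)` and that some nonzero first-order motion of the line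
preserves the multiplicities. -/
def IsChartBad {K : Type*} [Field K] (F : MvPolynomial (Fin 2 ⊕ Fin q) K) {k : ℕ} (m : Fin k → ℕ) :
    Prop :=
  ∃ (α : Fin k → K) (c : K), restrictLine F = lineForm m α c ∧
    ∃ v : Fin 2 × Fin q → K, v ≠ 0 ∧
      ramification m α ∣ ∑ a, Polynomial.C (v a) * variation F a

theorem restrictLine_monomial (α : (Fin 2 ⊕ Fin q) →₀ ℕ) (a : A) :
    restrictLine (MvPolynomial.monomial α a) =
      if ∃ j, α (Sum.inr j) ≠ 0 then 0 else MvPolynomial.monomial α a := by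
  rw [restrictLine, MvPolynomial.aeval_monomial, Finsupp.prod_fintype _ _ fun i => pow_zero _]
  split_ifs with h
  · obtain ⟨j, hj⟩ := h
    rw [Finset.prod_eq_zero (Finset.mem_univ (Sum.inr j)), mul_zero]
    simp [hj]
  · push Not at h
    rw [MvPolynomial.monomial_eq, Finsupp.prod_fintype _ _ fun i => pow_zero _]
    rw [MvPolynomial.algebraMap_eq]
    congr 1
    refine Finset.prod_congr rfl fun i _ => ?_
    rcases i with i | j
    · rfl
    · simp [h j]

/-- A form is determined by its restriction to the line `y = 0` and its coefficients at the
monomials divisible by some transverse coordinate. -/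
theorem sum_monomial_add_restrictLine {F : MvPolynomial (Fin 2 ⊕ Fin q) A} {d : ℕ}
    (hF : F.IsHomogeneous d)
    [Fintype {α : (Fin 2 ⊕ Fin q) →₀ ℕ // α.degree = d ∧ ∃ j, α (Sum.inr j) ≠ 0}] :
    ∑ α : {α : (Fin 2 ⊕ Fin q) →₀ ℕ // α.degree = d ∧ ∃ j, α (Sum.inr j) ≠ 0},
      MvPolynomial.monomial α.val (F.coeff α.val) + restrictLine F = F := by
  classical
  have hdeg : ∀ α, F.coeff α ≠ 0 → α.degree = d := by
    intro α h
    have h2 := hF h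
    rw [Finsupp.weight_apply] at h2
    simpa [Finsupp.sum, Finsupp.degree_apply] using h2
  have h1 : restrictLine F = ∑ α ∈ F.support,
      if ∃ j, α (Sum.inr j) ≠ 0 then 0 else MvPolynomial.monomial α (F.coeff α) := by
    conv_lhs => rw [F.as_sum]
    rw [restrictLine, map_sum]
    exact Finset.sum_congr rfl fun α _ => restrictLine_monomial α _
  have h2 : ∑ α : {α : (Fin 2 ⊕ Fin q) →₀ ℕ // α.degree = d ∧ ∃ j, α (Sum.inr j) ≠ 0},
      MvPolynomial.monomial α.val (F.coeff α.val) = ∑ α ∈ F.support,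
      if ∃ j, α (Sum.inr j) ≠ 0 then MvPolynomial.monomial α (F.coeff α) else 0 := by
    rw [← Finset.sum_filter]
    symm
    refine Finset.sum_bij_ne_zero (fun α hα _ => ⟨α, ?_, ?_⟩) (fun _ _ _ => Finset.mem_univ _)
      (fun _ _ _ _ _ _ h => congrArg Subtype.val h) (fun α _ hα => ?_) fun _ _ _ => rfl
    · exact hdeg α (MvPolynomial.mem_support_iff.mp (Finset.mem_filter.mp hα).1)
    · exact (Finset.mem_filter.mp hα).2
    · refine ⟨α.val, Finset.mem_filter.mpr ⟨?_, α.property.2⟩, hα, rfl⟩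
      rw [MvPolynomial.mem_support_iff]
      intro h0
      rw [h0, map_zero] at hα
      exact hα rfl
  rw [h1, h2, ← Finset.sum_add_distrib]
  conv_rhs => rw [F.as_sum]
  refine Finset.sum_congr rfl fun α _ => ?_
  split_ifs <;> simp

end Slope

/-! ### The hypersurface of forms with a bad line in a given chart -/

/-- The parameters of the forms with a given factorization type along a line of a chart: the
coefficients at the monomials divisible by a transverse coordinate, the coordinates of the line in
the chart, the roots `α_j` and the leading coefficient `c`. -/
abbrev ChartParam (q d k : ℕ) : Type :=
  {α : (Fin 2 ⊕ Fin q) →₀ ℕ // α.degree = d ∧ ∃ j, α (Sum.inr j) ≠ 0} ⊕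
    ((Fin 2 × Fin q) ⊕ (Fin k ⊕ Unit))

instance finite_transverseMonomial (q d : ℕ) :
    Finite {α : (Fin 2 ⊕ Fin q) →₀ ℕ // α.degree = d ∧ ∃ j, α (Sum.inr j) ≠ 0} :=
  Set.Finite.subset (Finsupp.finite_of_degree_eq d) fun _ h => h.1

/-- There are no more parameters than monomials of degree `d`: the `2q + k + 1 = d + 1` last
parameters make up for the monomials in the two coordinates of the line. -/
def chartParamEmbedding {q d k : ℕ} (h : 2 * q + k = d) :
    ChartParam q d k ↪ {α : (Fin 2 ⊕ Fin q) →₀ ℕ // α.degree = d} :=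
  let e : (Fin 2 × Fin q) ⊕ (Fin k ⊕ Unit) ≃ Fin (d + 1) := Fintype.equivFinOfCardEq (by
    simp only [Fintype.card_sum, Fintype.card_prod, Fintype.card_fin, Fintype.card_unit]
    omega)
  { toFun := Sum.elim (fun α => ⟨α.val, α.property.1⟩) fun z =>
      ⟨Finsupp.single (Sum.inl 0) (e z : ℕ) + Finsupp.single (Sum.inl 1) (d - e z), by
        have := (e z).isLt
        rw [map_add, Finsupp.degree_single, Finsupp.degree_single]
        omega⟩
    inj' := by
      rintro (⟨α, hα, j, hj⟩ | z) (⟨β, hβ, j', hj'⟩ | w) hzw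
      · simpa using hzw
      · exfalso
        apply hj
        have h1 := congrArg Subtype.val hzw
        simp only [Sum.elim_inl, Sum.elim_inr] at h1
        rw [h1]
        simp
      · exfalso
        apply hj'
        have h1 := congrArg Subtype.val hzw
        simp only [Sum.elim_inl, Sum.elim_inr] at h1
        rw [← h1]
        simp
      · have h1 := congrArg (fun γ => γ.val (Sum.inl 0)) hzw
        simp only [Sum.elim_inr, Finsupp.add_apply] at h1
        have h2 : (e z : ℕ) = e w := by simpa using h1
        rw [e.injective (Fin.ext h2)] }

/-- The general form with a given factorization type along the line `y = 0`. -/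
def genericForm (K : Type*) [Field K] (q d : ℕ) {k : ℕ} (m : Fin k → ℕ) :
    MvPolynomial (Fin 2 ⊕ Fin q) (MvPolynomial (ChartParam q d k) K) :=
  letI := Fintype.ofFinite {α : (Fin 2 ⊕ Fin q) →₀ ℕ // α.degree = d ∧ ∃ j, α (Sum.inr j) ≠ 0}
  ∑ α : {α : (Fin 2 ⊕ Fin q) →₀ ℕ // α.degree = d ∧ ∃ j, α (Sum.inr j) ≠ 0},
      MvPolynomial.monomial α.val (MvPolynomial.X (Sum.inl α)) +
    lineForm (A := MvPolynomial (ChartParam q d k) K) m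
      (fun j => MvPolynomial.X (Sum.inr (Sum.inr (Sum.inl j))))
      (MvPolynomial.X (Sum.inr (Sum.inr (Sum.inr ()))))

/-- The parameters of a given form. -/
def chartParamOf {K : Type*} [Field K] {q d k : ℕ} (F : MvPolynomial (Fin 2 ⊕ Fin q) K)
    (w : Fin 2 × Fin q → K) (α : Fin k → K) (c : K) : ChartParam q d k → K :=
  Sum.elim (fun β => F.coeff β.val) (Sum.elim w (Sum.elim α fun _ => c))

theorem map_lineForm {A B : Type*} [CommRing A] [CommRing B] (φ : A →+* B) {q k : ℕ}
    (m : Fin k → ℕ) (α : Fin k → A) (c : A) :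
    MvPolynomial.map φ (lineForm (q := q) m α c) = lineForm m (φ ∘ α) (φ c) := by
  simp [lineForm, map_prod]

theorem map_genericForm {K : Type*} [Field K] {q d k : ℕ} {m : Fin k → ℕ}
    {F : MvPolynomial (Fin 2 ⊕ Fin q) K} (hF : F.IsHomogeneous d) {α : Fin k → K} {c : K}
    (h : restrictLine F = lineForm m α c) (w : Fin 2 × Fin q → K) :
    MvPolynomial.map (MvPolynomial.eval (chartParamOf F w α c)) (genericForm K q d m) = F := by
  let := Fintype.ofFinite {α : (Fin 2 ⊕ Fin q) →₀ ℕ // α.degree = d ∧ ∃ j, α (Sum.inr j) ≠ 0}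
  conv_rhs => rw [← sum_monomial_add_restrictLine hF, h]
  rw [genericForm, map_add, map_lineForm, map_sum]
  congr 1
  · refine Finset.sum_congr rfl fun β _ => ?_
    rw [MvPolynomial.map_monomial, MvPolynomial.eval_X]
    rfl
  · congr 1
    · funext j
      simp [chartParamOf]
    · simp [chartParamOf]

/-- The discriminant of the family `genericForm`: it vanishes where some first-order motion of the
line preserves the multiplicities. -/
def chartDiscriminant (K : Type*) [Field K] (q d : ℕ) {k : ℕ} (m : Fin k → ℕ) :
    MvPolynomial (ChartParam q d k) K :=
  (variationMatrix (genericForm K q d m) m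
    fun j => MvPolynomial.X (Sum.inr (Sum.inr (Sum.inl j)))).det

theorem eval_chartDiscriminant {K : Type*} [Field K] {q d k : ℕ} {m : Fin k → ℕ}
    {F : MvPolynomial (Fin 2 ⊕ Fin q) K} (hF : F.IsHomogeneous d) {α : Fin k → K} {c : K}
    (h : restrictLine F = lineForm m α c) (w : Fin 2 × Fin q → K) :
    MvPolynomial.eval (chartParamOf F w α c) (chartDiscriminant K q d m) =
      (variationMatrix F m α).det := by
  rw [chartDiscriminant, RingHom.map_det]
  congr 1
  have h1 := map_variationMatrix (MvPolynomial.eval (chartParamOf (d := d) F w α c))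
    (genericForm K q d m) m fun j => MvPolynomial.X (Sum.inr (Sum.inr (Sum.inl j)))
  rw [map_genericForm hF h] at h1
  refine h1.trans ?_
  congr 1
  funext j
  simp [chartParamOf]

/-- The form `s ^ d + ∑_j y_j s ^ (2 j) t ^ (d - 1 - 2 j)`. With all roots `α_j` equal to `0`, its
`variation`s are the powers of `z` below `z ^ (2 q)`, which are independent modulo
`ramification m 0 = z ^ (2 q)`. -/
def sampleForm (K : Type*) [Field K] (q d : ℕ) : MvPolynomial (Fin 2 ⊕ Fin q) K :=
  MvPolynomial.X (Sum.inl 0) ^ d + ∑ j : Fin q, MvPolynomial.X (Sum.inr j) *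
    (MvPolynomial.X (Sum.inl 0) ^ (2 * (j : ℕ)) *
      MvPolynomial.X (Sum.inl 1) ^ (d - 1 - 2 * (j : ℕ)))

theorem isHomogeneous_sampleForm (K : Type*) [Field K] {q d : ℕ} (h : 2 * q ≤ d) :
    (sampleForm K q d).IsHomogeneous d := by
  refine MvPolynomial.IsHomogeneous.add (by simpa using (MvPolynomial.isHomogeneous_X K _).pow d)
    (MvPolynomial.IsHomogeneous.sum _ _ _ fun j _ => ?_)
  have h1 := (MvPolynomial.isHomogeneous_X K (Sum.inr j : Fin 2 ⊕ Fin q)).mul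
    (((MvPolynomial.isHomogeneous_X K (Sum.inl 0 : Fin 2 ⊕ Fin q)).pow (2 * (j : ℕ))).mul
    ((MvPolynomial.isHomogeneous_X K (Sum.inl 1 : Fin 2 ⊕ Fin q)).pow (d - 1 - 2 * (j : ℕ))))
  have h2 := j.isLt
  convert h1 using 1
  omega

theorem restrictLine_sampleForm (K : Type*) [Field K] {q d k : ℕ} {m : Fin k → ℕ}
    (hm : ∑ j, m j = d) : restrictLine (sampleForm K q d) = lineForm m 0 1 := by
  rw [restrictLine, sampleForm, lineForm, ← hm]
  simp [Finset.prod_pow_eq_pow_sum]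

theorem variation_sampleForm (K : Type*) [Field K] {q d : ℕ} (a : Fin 2 × Fin q) :
    variation (sampleForm K q d) a = Polynomial.X ^ (2 * (a.2 : ℕ) + (1 - (a.1 : ℕ))) := by
  obtain ⟨i, j⟩ := a
  have h : slope (sampleForm K q d) j = Polynomial.X ^ (2 * (j : ℕ)) := by
    rw [slope, sampleForm]
    simp [Derivation.leibniz_pow, Derivation.leibniz, MvPolynomial.pderiv_X, Pi.single_apply]
  rw [variation, h]
  fin_cases i <;> simp [pow_succ, mul_comm]

theorem chartDiscriminant_ne_zero (K : Type*) [Field K] {q d k : ℕ} {m : Fin k → ℕ}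
    (hm : ∑ j, m j = d) (hm' : ∑ j, (m j - 1) = 2 * q) : chartDiscriminant K q d m ≠ 0 := by
  intro h0
  have hqd : 2 * q ≤ d := by
    rw [← hm, ← hm']
    exact Finset.sum_le_sum fun j _ => Nat.sub_le _ _
  have h1 := eval_chartDiscriminant (isHomogeneous_sampleForm K hqd)
    (restrictLine_sampleForm K hm) 0
  rw [h0, map_zero] at h1
  obtain ⟨v, hv, hdvd⟩ := (det_variationMatrix_eq_zero_iff _ m hm' 0).mp h1.symm
  have h2 : ramification m (0 : Fin k → K) = Polynomial.X ^ (2 * q) := by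
    rw [ramification, ← hm', ← Finset.prod_pow_eq_pow_sum]
    simp
  rw [h2, Polynomial.X_pow_dvd_iff] at hdvd
  refine hv (funext fun a => ?_)
  have ha := a.2.isLt
  have h3 := hdvd (2 * (a.2 : ℕ) + (1 - (a.1 : ℕ))) (by omega)
  rw [Polynomial.finsetSum_coeff, Finset.sum_eq_single a] at h3
  · simpa [variation_sampleForm] using h3
  · intro b _ hb
    rw [variation_sampleForm, Polynomial.coeff_C_mul, Polynomial.coeff_X_pow, if_neg, mul_zero]
    intro h4
    apply hb
    have hb1 := b.1.isLt
    have ha1 := a.1.isLt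
    exact Prod.ext (Fin.ext (by omega)) (Fin.ext (by omega))
  · intro h; exact absurd (Finset.mem_univ a) h

theorem map_aeval_eq {A B V W : Type*} [CommRing A] [CommRing B] (φ : A →+* B)
    (f : V → MvPolynomial W A) (G : MvPolynomial V A) :
    MvPolynomial.map φ (MvPolynomial.aeval f G) =
      MvPolynomial.aeval (fun v => MvPolynomial.map φ (f v)) (MvPolynomial.map φ G) := by
  induction G using MvPolynomial.induction_on with
  | C a => simp [MvPolynomial.algebraMap_eq]
  | add p q hp hq => simp only [map_add, hp, hq]
  | mul_X p i hp => simp only [map_mul, hp, MvPolynomial.aeval_X, MvPolynomial.map_X]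

theorem sum_sub_one_add {k : ℕ} {m : Fin k → ℕ} (hm : ∀ j, 0 < m j) :
    ∑ j, (m j - 1) + k = ∑ j, m j := by
  have h : ∑ j, (m j - 1) + ∑ _j : Fin k, 1 = ∑ j, m j := by
    rw [← Finset.sum_add_distrib]
    exact Finset.sum_congr rfl fun j _ => Nat.sub_add_cancel (hm j)
  simpa using h

/-- For a family `l` of substitutions parametrized by the coordinates of the line in the
chart, the forms obtained by substitution from those with a bad line `y = 0` lie in a
hypersurface. -/
theorem exists_hypersurface_of_chart {K : Type*} [Field K] {q d k : ℕ} {m : Fin k → ℕ}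
    (hm : ∑ j, m j = d) (hpos : ∀ j, 0 < m j) (hm' : ∑ j, (m j - 1) = 2 * q) {W : Type*}
    (E : Fin 2 ⊕ Fin q ≃ W)
    (l : Fin 2 ⊕ Fin q → MvPolynomial W (MvPolynomial (Fin 2 × Fin q) K)) :
    ∃ Φ : MvPolynomial {α : W →₀ ℕ // α.degree = d} K, Φ ≠ 0 ∧
      ∀ (F : MvPolynomial (Fin 2 ⊕ Fin q) K) (w : Fin 2 × Fin q → K), F.IsHomogeneous d →
        IsChartBad F m →
        MvPolynomial.eval (fun α => MvPolynomial.coeff α.val (MvPolynomial.aeval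
          (fun v => MvPolynomial.map (MvPolynomial.eval w) (l v)) F)) Φ = 0 := by
  have hk : 2 * q + k = d := by
    have h1 := sum_sub_one_add hpos
    omega
  let ι : ChartParam q d k ↪ {α : W →₀ ℕ // α.degree = d} :=
    (chartParamEmbedding hk).trans
      ⟨fun α => ⟨Finsupp.equivMapDomain E α.val, by
        rw [Finsupp.equivMapDomain_eq_mapDomain, Finsupp.degree_mapDomain, α.property]⟩,
      fun α β h => Subtype.ext ((Finsupp.equivCongrLeft E).injective (congrArg Subtype.val h))⟩
  let ψ : MvPolynomial W (MvPolynomial (ChartParam q d k) K) := MvPolynomial.aeval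
    (fun v => MvPolynomial.map (MvPolynomial.rename (Sum.inr ∘ Sum.inl)).toRingHom (l v))
    (genericForm K q d m)
  obtain ⟨Φ, hΦ, h⟩ := exists_ne_zero_eval_eq_zero ι (fun α => ψ.coeff α.val)
    (chartDiscriminant K q d m) (chartDiscriminant_ne_zero K hm hm')
  refine ⟨Φ, hΦ, fun F w hF hbad => ?_⟩
  obtain ⟨α, c, hr, hv⟩ := hbad
  have h0 : MvPolynomial.eval (chartParamOf F w α c) (chartDiscriminant K q d m) = 0 := by
    rw [eval_chartDiscriminant hF hr]
    exact (det_variationMatrix_eq_zero_iff F m hm' α).mpr hv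
  have h1 := h _ h0
  have h2 : MvPolynomial.map (MvPolynomial.eval (chartParamOf F w α c)) ψ = MvPolynomial.aeval
      (fun v => MvPolynomial.map (MvPolynomial.eval w) (l v)) F := by
    rw [map_aeval_eq, map_genericForm hF hr]
    congr 2
    funext v
    rw [MvPolynomial.map_map]
    congr 1
    refine MvPolynomial.ringHom_ext (fun x => ?_) fun a => ?_
    · simp only [RingHom.comp_apply, MvPolynomial.map_C]
      exact congrArg _ (MvPolynomial.eval_rename _ _ _)
    · simp
  simp only [← MvPolynomial.coeff_map, h2] at h1
  exact h1

/-! ### Restricting forms to families of lines -/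

section PullForm

variable {K A B W : Type*} [CommRing K] [CommRing A] [CommRing B] [Algebra K A] [Algebra K B]

/-- The linear form `a_0 s + a_1 t`. -/
def linForm (a : Fin 2 → A) : MvPolynomial (Fin 2) A :=
  ∑ i, MvPolynomial.C (a i) * MvPolynomial.X i

/-- The restriction of the form `F` to the line spanned by the frame `w_0, w_1` with entries in a
`K`-algebra: the form `F (s w_0 + t w_1)` in `s, t`. -/
def pullForm (F : MvPolynomial W K) (w : Matrix (Fin 2) W A) : MvPolynomial (Fin 2) A :=
  MvPolynomial.aeval (fun l => linForm fun i => w i l) F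

theorem map_linForm (φ : A →+* B) (a : Fin 2 → A) :
    MvPolynomial.map φ (linForm a) = linForm fun i => φ (a i) := by
  simp [linForm]

theorem changeCoord_linForm (g : GL (Fin 2) A) (a : Fin 2 → A) :
    changeCoord g (linForm a) = linForm (Matrix.vecMul a g.val) := by
  simp only [linForm, changeCoord, map_mul, MvPolynomial.algHom_C, MvPolynomial.aeval_X,
    MvPolynomial.algebraMap_eq, Matrix.vecMul, dotProduct, Fin.sum_univ_two, map_add]
  ring

theorem map_pullForm (φ : A →ₐ[K] B) (F : MvPolynomial W K) (w : Matrix (Fin 2) W A) :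
    MvPolynomial.map (φ : A →+* B) (pullForm F w) = pullForm F (w.map φ) := by
  induction F using MvPolynomial.induction_on with
  | C a => simp [pullForm, MvPolynomial.algebraMap_apply]
  | add p q hp hq => simp only [pullForm, map_add] at hp hq ⊢; rw [hp, hq]
  | mul_X p i hp =>
    simp only [pullForm, map_mul, MvPolynomial.aeval_X, map_linForm] at hp ⊢
    rw [hp]
    rfl

theorem changeCoord_pullForm (g : GL (Fin 2) A) (F : MvPolynomial W K)
    (w : Matrix (Fin 2) W A) :
    changeCoord g (pullForm F w) = pullForm F (g.val.transpose * w) := by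
  induction F using MvPolynomial.induction_on with
  | C a => simp [pullForm, changeCoord, MvPolynomial.algebraMap_apply, MvPolynomial.algebraMap_eq]
  | add p q hp hq =>
    simp only [pullForm, map_add] at hp hq ⊢
    rw [← hp, ← hq]
    exact map_add _ _ _
  | mul_X p i hp =>
    simp only [pullForm, map_mul, MvPolynomial.aeval_X] at hp ⊢
    rw [changeCoord_mul, hp, changeCoord_linForm]
    congr 2
    funext j
    simp only [Matrix.vecMul, dotProduct, Matrix.mul_apply, Matrix.transpose_apply]
    exact Finset.sum_congr rfl fun i _ => mul_comm _ _

end PullForm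

/-! ### First-order motions of a line preserving the multiplicities -/

/-- A frame over `K`, viewed as a constant frame over the dual numbers. -/
def constFrame {K W : Type*} [Field K] (x : Matrix (Fin 2) W K) :
    Matrix (Fin 2) W (DualNumber K) :=
  fun i l => TrivSqZeroExt.inl (x i l)

/-- The frame `w` over the dual numbers is a first-order motion of a line not contained in `F = 0`
that is not constant up to a change of frame, and along which the restriction of `F` remains a
product of powers `(m_j)` of linear forms. -/
structure BadFrame {K W : Type*} [Field K] (F : MvPolynomial W K) {k : ℕ} (m : Fin k → ℕ)
    (w : Matrix (Fin 2) W (DualNumber K)) : Prop where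
  not_const : ∀ (H : Matrix (Fin 2) (Fin 2) (DualNumber K)) (x : Matrix (Fin 2) W K),
    w ≠ H * constFrame x
  factor : ∃ (c : DualNumber K) (L : Fin k → Fin 2 → DualNumber K),
    pullForm F w = MvPolynomial.C c * ∏ j, linForm (L j) ^ m j
  ne_zero : pullForm F (w.map TrivSqZeroExt.fst) ≠ 0

section BadFrame

variable {K W : Type*} [Field K] {F : MvPolynomial W K} {k : ℕ} {m : Fin k → ℕ}
  {w : Matrix (Fin 2) W (DualNumber K)}

theorem map_fst_pullForm (F : MvPolynomial W K) (w : Matrix (Fin 2) W (DualNumber K)) :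
    MvPolynomial.map (TrivSqZeroExt.fstHom K K K : DualNumber K →+* K) (pullForm F w) =
      pullForm F (w.map TrivSqZeroExt.fst) :=
  map_pullForm (TrivSqZeroExt.fstHom K K K) F w

theorem BadFrame.mul (h : BadFrame F m w) (H : GL (Fin 2) (DualNumber K)) :
    BadFrame F m (H.val * w) := by
  obtain ⟨hc, ⟨c, L, hL⟩, hne⟩ := h
  let g : GL (Fin 2) (DualNumber K) :=
    ⟨H.val.transpose, H⁻¹.val.transpose, by
      rw [← Matrix.transpose_mul, ← Units.val_mul, inv_mul_cancel, Units.val_one,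
        Matrix.transpose_one], by
      rw [← Matrix.transpose_mul, ← Units.val_mul, mul_inv_cancel, Units.val_one,
        Matrix.transpose_one]⟩
  have hg : pullForm F (H.val * w) = changeCoord g (pullForm F w) := by
    rw [changeCoord_pullForm]
    simp [g]
  refine ⟨fun H' x h' => ?_, ⟨c, fun j => Matrix.vecMul (L j) g.val, ?_⟩, ?_⟩
  · apply hc (H⁻¹.val * H') x
    rw [Matrix.mul_assoc, ← h', ← Matrix.mul_assoc, ← Units.val_mul, inv_mul_cancel,
      Units.val_one, Matrix.one_mul]
  · rw [hg, hL, changeCoord_mul, changeCoord_C, changeCoord_prod]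
    simp only [changeCoord_pow, changeCoord_linForm]
  · rw [← map_fst_pullForm, hg, map_changeCoord, map_fst_pullForm]
    intro h0
    apply hne
    rw [← changeCoord_inv_changeCoord _ (pullForm F (w.map TrivSqZeroExt.fst)), h0]
    exact map_zero _

/-- In the dual numbers, `snd (y ∏ x_j ^ m_j)` is divisible by `∏ (fst x_j) ^ (m_j - 1)`. -/
theorem prod_fst_pow_dvd_snd {S ι : Type*} [CommRing S] (s : Finset ι) (m : ι → ℕ)
    (x : ι → DualNumber S) (y : DualNumber S) :
    ∏ j ∈ s, (x j).fst ^ (m j - 1) ∣ (y * ∏ j ∈ s, x j ^ m j).snd := by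
  classical
  have hpow : ∀ (x : DualNumber S) (n : ℕ), x.fst ^ (n - 1) ∣ (x ^ n).fst := fun x n => by
    rw [TrivSqZeroExt.fst_pow]
    exact pow_dvd_pow _ (Nat.sub_le n 1)
  have key : ∏ j ∈ s, (x j).fst ^ (m j - 1) ∣ (∏ j ∈ s, x j ^ m j).fst ∧
      ∏ j ∈ s, (x j).fst ^ (m j - 1) ∣ (∏ j ∈ s, x j ^ m j).snd := by
    induction s using Finset.induction_on with
    | empty => simp
    | insert j s hj ih =>
      rw [Finset.prod_insert hj, Finset.prod_insert hj]
      refine ⟨?_, ?_⟩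
      · rw [TrivSqZeroExt.fst_mul]
        exact mul_dvd_mul (hpow _ _) ih.1
      · rw [DualNumber.snd_mul]
        refine dvd_add (mul_dvd_mul (hpow _ _) ih.2) (mul_dvd_mul ?_ ih.1)
        rw [TrivSqZeroExt.snd_pow]
        simp only [Nat.pred_eq_sub_one, smul_eq_mul, nsmul_eq_mul]
        exact Dvd.dvd.mul_left (dvd_mul_right _ _) _
  rw [DualNumber.snd_mul]
  exact dvd_add (Dvd.dvd.mul_left key.2 _) (Dvd.dvd.mul_left key.1 _)

/-- The first-order Taylor expansion of a polynomial over the dual numbers. -/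
theorem snd_aeval_dualNumber {S V : Type*} [CommRing S] [Algebra K S] [Fintype V]
    (F : MvPolynomial V K) (x : V → DualNumber S) :
    (MvPolynomial.aeval x F).fst = MvPolynomial.aeval (fun v => (x v).fst) F ∧
    (MvPolynomial.aeval x F).snd =
      ∑ v, (x v).snd * MvPolynomial.aeval (fun v => (x v).fst) (MvPolynomial.pderiv v F) := by
  classical
  induction F using MvPolynomial.induction_on with
  | C a => simp [TrivSqZeroExt.algebraMap_eq_inl']
  | add p q hp hq =>
    simp only [map_add, TrivSqZeroExt.fst_add, TrivSqZeroExt.snd_add, hp, hq, mul_add,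
      Finset.sum_add_distrib, and_self]
  | mul_X p i hp =>
    obtain ⟨hp1, hp2⟩ := hp
    refine ⟨by simp [hp1], ?_⟩
    rw [map_mul, MvPolynomial.aeval_X, DualNumber.snd_mul, hp1, hp2]
    simp only [Derivation.leibniz, smul_eq_mul, map_add, map_mul, MvPolynomial.aeval_X, mul_add,
      Finset.sum_add_distrib, MvPolynomial.pderiv_X]
    congr 1
    · rw [Finset.sum_eq_single i]
      · simp [mul_comm]
      · intro v _ hv
        simp [hv.symm]
      · intro h; exact absurd (Finset.mem_univ i) h
    · rw [Finset.sum_mul]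
      exact Finset.sum_congr rfl fun v _ => by ring

end BadFrame

/-! ### Bringing a bad frame into a chart -/

section Chart

variable {K W : Type*} [Field K] {q : ℕ}

/-- The coordinates in which the line with coordinates `w` in the chart given by `E` is `y = 0`;
the first two are twisted by `γ` to move the point at infinity of the line. -/
def chartSubst {A : Type*} [CommRing A] (E : Fin 2 ⊕ Fin q ≃ W) (γ : A)
    (w : Fin 2 × Fin q → A) : Fin 2 ⊕ Fin q → MvPolynomial W A :=
  let l : Fin 2 → MvPolynomial W A := ![MvPolynomial.X (E (Sum.inl 0)),
    MvPolynomial.X (E (Sum.inl 1)) - MvPolynomial.C γ * MvPolynomial.X (E (Sum.inl 0))]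
  Sum.elim l fun j => MvPolynomial.X (E (Sum.inr j)) - ∑ i, MvPolynomial.C (w (i, j)) * l i

/-- The original coordinates in terms of those of `chartSubst`. -/
def chartSubstInv {A : Type*} [CommRing A] (E : Fin 2 ⊕ Fin q ≃ W) (γ : A)
    (w : Fin 2 × Fin q → A) (b : W) : MvPolynomial (Fin 2 ⊕ Fin q) A :=
  Sum.elim (![MvPolynomial.X (Sum.inl 0),
      MvPolynomial.X (Sum.inl 1) + MvPolynomial.C γ * MvPolynomial.X (Sum.inl 0)])
    (fun j => MvPolynomial.X (Sum.inr j) +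
      ∑ i, MvPolynomial.C (w (i, j)) * MvPolynomial.X (Sum.inl i)) (E.symm b)

theorem map_chartSubst {A B : Type*} [CommRing A] [CommRing B] (φ : A →+* B)
    (E : Fin 2 ⊕ Fin q ≃ W) (γ : A) (w : Fin 2 × Fin q → A) (v : Fin 2 ⊕ Fin q) :
    MvPolynomial.map φ (chartSubst E γ w v) = chartSubst E (φ γ) (φ ∘ w) v := by
  rcases v with i | j
  · fin_cases i <;> simp [chartSubst]
  · simp [chartSubst, Fin.sum_univ_two]

theorem aeval_chartSubst_chartSubstInv (E : Fin 2 ⊕ Fin q ≃ W) (γ : K) (w : Fin 2 × Fin q → K)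
    (F : MvPolynomial W K) :
    MvPolynomial.aeval (chartSubst E γ w) (MvPolynomial.aeval (chartSubstInv E γ w) F) = F := by
  rw [← AlgHom.comp_apply, MvPolynomial.comp_aeval]
  have h : (fun b => MvPolynomial.aeval (chartSubst E γ w) (chartSubstInv E γ w b)) =
      (MvPolynomial.X : W → MvPolynomial W K) := by
    funext b
    obtain ⟨v, rfl⟩ := E.surjective b
    rcases v with i | j
    · fin_cases i <;> simp [chartSubst, chartSubstInv, MvPolynomial.algebraMap_eq]
    · simp [chartSubst, chartSubstInv, MvPolynomial.algebraMap_eq, Fin.sum_univ_two]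
  rw [h, MvPolynomial.aeval_X_left, AlgHom.id_apply]

theorem isHomogeneous_aeval_chartSubstInv (E : Fin 2 ⊕ Fin q ≃ W) (γ : K)
    (w : Fin 2 × Fin q → K) {F : MvPolynomial W K} {d : ℕ} (hF : F.IsHomogeneous d) :
    (MvPolynomial.aeval (chartSubstInv E γ w) F).IsHomogeneous d := by
  have hX : ∀ v : Fin 2 ⊕ Fin q,
      (MvPolynomial.X v : MvPolynomial (Fin 2 ⊕ Fin q) K).IsHomogeneous 1 :=
    fun v => MvPolynomial.isHomogeneous_X K v
  have hCX : ∀ (a : K) (v : Fin 2 ⊕ Fin q),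
      (MvPolynomial.C a * MvPolynomial.X v : MvPolynomial (Fin 2 ⊕ Fin q) K).IsHomogeneous 1 :=
    fun a v => by simpa using (MvPolynomial.isHomogeneous_C _ a).mul (hX v)
  have h := hF.aeval (chartSubstInv E γ w) (n := 1) fun b => by
    obtain ⟨v, rfl⟩ := E.surjective b
    rcases v with i | j
    · fin_cases i
      · simpa [chartSubstInv] using hX _
      · simpa [chartSubstInv] using (hX _).add (hCX _ _)
    · simpa [chartSubstInv] using
        (hX _).add (MvPolynomial.IsHomogeneous.sum Finset.univ _ _ fun i _ => hCX (w (i, j)) _)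
  rwa [one_mul] at h

theorem exists_equiv_of_injective (E₀ : Fin 2 ⊕ Fin q ≃ W) (l : Fin 2 → W)
    (hl : Function.Injective l) : ∃ E : Fin 2 ⊕ Fin q ≃ W, ∀ i, E (Sum.inl i) = l i := by
  classical
  let E₁ := E₀.trans (Equiv.swap (E₀ (Sum.inl 0)) (l 0))
  have h0 : E₁ (Sum.inl 0) = l 0 := by simp [E₁]
  refine ⟨E₁.trans (Equiv.swap (E₁ (Sum.inl 1)) (l 1)), fun i => ?_⟩
  fin_cases i
  · change Equiv.swap (E₁ (Sum.inl 1)) (l 1) (E₁ (Sum.inl 0)) = l 0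
    rw [h0]
    refine Equiv.swap_apply_of_ne_of_ne ?_ (fun h => ?_)
    · rw [← h0]
      intro h
      simpa using E₁.injective h
    · simpa using hl h
  · exact Equiv.swap_apply_left _ _

/-- The homomorphism to `K[z][ε]` given by `s = z` and `t = 1`. -/
def dehomogenizeDual (K : Type*) [Field K] :
    MvPolynomial (Fin 2) (DualNumber K) →+* DualNumber (Polynomial K) :=
  MvPolynomial.eval₂Hom
    (DualNumber.lift ⟨(Algebra.ofId K (DualNumber (Polynomial K)), DualNumber.eps), by
      simp, fun _ => mul_comm _ _⟩ : DualNumber K →ₐ[K] DualNumber (Polynomial K)).toRingHom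
    ![TrivSqZeroExt.inl Polynomial.X, 1]

theorem dehomogenizeDual_C (x : DualNumber K) :
    dehomogenizeDual K (MvPolynomial.C x) =
      TrivSqZeroExt.inl (Polynomial.C x.fst) + TrivSqZeroExt.inr (Polynomial.C x.snd) := by
  rw [dehomogenizeDual, MvPolynomial.coe_eval₂Hom, MvPolynomial.eval₂_C]
  refine (DualNumber.lift_apply_apply _ x).trans ?_
  refine TrivSqZeroExt.ext ?_ ?_
  · simp [Algebra.ofId_apply, TrivSqZeroExt.algebraMap_eq_inl']
  · simp [Algebra.ofId_apply, TrivSqZeroExt.algebraMap_eq_inl']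

theorem dehomogenizeDual_linForm (a : Fin 2 → DualNumber K) :
    dehomogenizeDual K (linForm a) =
      TrivSqZeroExt.inl (∑ i, Polynomial.C (a i).fst * ![Polynomial.X, 1] i) +
      TrivSqZeroExt.inr (∑ i, Polynomial.C (a i).snd * ![Polynomial.X, 1] i) := by
  have h0 : dehomogenizeDual K (MvPolynomial.X 0) = TrivSqZeroExt.inl Polynomial.X := by
    simp [dehomogenizeDual]
  have h1 : dehomogenizeDual K (MvPolynomial.X 1) = 1 := by
    simp [dehomogenizeDual]
  rw [linForm, Fin.sum_univ_two, map_add, map_mul, map_mul, h0, h1, dehomogenizeDual_C,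
    dehomogenizeDual_C]
  ext <;> simp

theorem dehomogenizeDual_pullForm (F : MvPolynomial W K) (w : Matrix (Fin 2) W (DualNumber K)) :
    dehomogenizeDual K (pullForm F w) =
      MvPolynomial.aeval (fun b => dehomogenizeDual K (linForm fun i => w i b)) F := by
  induction F using MvPolynomial.induction_on with
  | C a =>
    rw [pullForm, MvPolynomial.algHom_C, MvPolynomial.algHom_C, MvPolynomial.algebraMap_apply,
      dehomogenizeDual_C, TrivSqZeroExt.algebraMap_eq_inl', TrivSqZeroExt.algebraMap_eq_inl']
    simp
  | add p q hp hq => simp only [pullForm, map_add] at hp hq ⊢; rw [hp, hq]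
  | mul_X p i hp =>
    simp only [pullForm, map_mul, MvPolynomial.aeval_X] at hp ⊢
    rw [hp]

/-- A bad frame normalized to be the frame of a chart, whose roots all lie in the finite part of
the line, makes the form bad in the coordinates of the chart. -/
theorem isChartBad_of_frame {F : MvPolynomial W K} {k : ℕ} {m : Fin k → ℕ}
    (E : Fin 2 ⊕ Fin q ≃ W) (γ : K) (w : Matrix (Fin 2) W (DualNumber K))
    (h00 : w 0 (E (Sum.inl 0)) = 1) (h01 : w 0 (E (Sum.inl 1)) = TrivSqZeroExt.inl γ)
    (h10 : w 1 (E (Sum.inl 0)) = 0) (h11 : w 1 (E (Sum.inl 1)) = 1)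
    (hnc : ∀ (H : Matrix (Fin 2) (Fin 2) (DualNumber K)) (x : Matrix (Fin 2) W K),
      w ≠ H * constFrame x)
    (c : DualNumber K) (L : Fin k → Fin 2 → DualNumber K)
    (hL : pullForm F w = MvPolynomial.C c * ∏ j, linForm (L j) ^ m j)
    (hL0 : ∀ j, (L j 0).fst ≠ 0) :
    IsChartBad (MvPolynomial.aeval
      (chartSubstInv E γ fun a => (w a.1 (E (Sum.inr a.2))).fst) F) m := by
  let A : Fin 2 × Fin q → K := fun a => (w a.1 (E (Sum.inr a.2))).fst
  let F' := MvPolynomial.aeval (chartSubstInv E γ A) F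
  refine ⟨fun j => -(L j 1).fst / (L j 0).fst, c.fst * ∏ j, (L j 0).fst ^ m j, ?_,
    fun a => (w a.1 (E (Sum.inr a.2))).snd, ?_, ?_⟩
  · -- the restriction to the line is the reduction of the factorization modulo `ε`
    have h1 : restrictLine F' =
        MvPolynomial.rename Sum.inl (pullForm F (w.map TrivSqZeroExt.fst)) := by
      rw [restrictLine, pullForm, ← AlgHom.comp_apply, ← AlgHom.comp_apply,
        MvPolynomial.comp_aeval, MvPolynomial.comp_aeval]
      congr 2
      funext b
      obtain ⟨v, rfl⟩ := E.surjective b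
      rcases v with i | j
      · fin_cases i
        · simp [chartSubstInv, linForm, h00, h10]
        · simp [chartSubstInv, linForm, h01, h11, add_comm]
      · simp [chartSubstInv, linForm, A, Fin.sum_univ_two, MvPolynomial.algebraMap_eq]
    have h2 := congrArg
      (MvPolynomial.map (TrivSqZeroExt.fstHom K K K : DualNumber K →+* K)) hL
    rw [map_fst_pullForm] at h2
    change restrictLine F' = _
    rw [h1, h2, lineForm]
    simp only [map_mul, map_prod, map_pow, map_linForm, MvPolynomial.map_C, MvPolynomial.rename_C,
      mul_assoc, ← Finset.prod_mul_distrib, ← mul_pow]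
    congr 1
    refine Finset.prod_congr rfl fun j _ => ?_
    congr 1
    have h3 : (MvPolynomial.C (L j 0).fst : MvPolynomial (Fin 2 ⊕ Fin q) K) *
        MvPolynomial.C (-(L j 1).fst / (L j 0).fst) = -MvPolynomial.C (L j 1).fst := by
      rw [← MvPolynomial.C_mul, mul_div_cancel₀ _ (hL0 j), MvPolynomial.C_neg]
    rw [mul_sub, ← mul_assoc, h3]
    simp [linForm]
  · intro h0
    apply hnc 1 (w.map TrivSqZeroExt.fst)
    rw [Matrix.one_mul]
    have hsnd : ∀ i b, (w i b).snd = 0 := by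
      intro i b
      obtain ⟨v, rfl⟩ := E.surjective b
      rcases v with i' | j
      · fin_cases i <;> fin_cases i' <;> simp [h00, h01, h10, h11]
      · exact congrFun h0 (i, j)
    ext i b
    · rfl
    · exact hsnd i b
  · -- the coefficient of `ε` in the factorization
    have h1 := congrArg (dehomogenizeDual K) hL
    rw [dehomogenizeDual_pullForm] at h1
    have h2 : F = MvPolynomial.aeval (chartSubst E γ A) F' :=
      (aeval_chartSubst_chartSubstInv E γ A F).symm
    let x : Fin 2 ⊕ Fin q → DualNumber (Polynomial K) := Sum.elim
      (fun i => TrivSqZeroExt.inl (![Polynomial.X, 1] i))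
      fun j => TrivSqZeroExt.inr
        (∑ i, Polynomial.C (w i (E (Sum.inr j))).snd * ![Polynomial.X, 1] i)
    have h3 : MvPolynomial.aeval (fun b => dehomogenizeDual K (linForm fun i => w i b)) F =
        MvPolynomial.aeval x F' := by
      conv_lhs => rw [h2]
      rw [← AlgHom.comp_apply, MvPolynomial.comp_aeval]
      congr 2
      funext v
      have hC : ∀ a : K, algebraMap K (DualNumber (Polynomial K)) a =
          TrivSqZeroExt.inl (Polynomial.C a) := fun a => rfl
      rcases v with i | j
      · fin_cases i <;> ext1 <;>
          simp [chartSubst, dehomogenizeDual_linForm, h00, h01, h10, h11, x, hC]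
      · ext1 <;>
          simp [chartSubst, dehomogenizeDual_linForm, h00, h01, h10, h11, x, hC, A,
            Fin.sum_univ_two]
    have h4 := (snd_aeval_dualNumber F' x).2
    have h5 : (fun v => (x v).fst) = Sum.elim ![Polynomial.X, 1] 0 := by
      funext v
      rcases v with i | j <;> simp [x]
    have h6 : (MvPolynomial.aeval x F').snd = ∑ a : Fin 2 × Fin q,
        Polynomial.C ((w a.1 (E (Sum.inr a.2))).snd) * variation F' a := by
      rw [h4, h5, Fintype.sum_sum_type, Fintype.sum_prod_type_right]
      simp only [x, Sum.elim_inl, Sum.elim_inr, TrivSqZeroExt.snd_inl, zero_mul,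
        Finset.sum_const_zero, zero_add, TrivSqZeroExt.snd_inr, Finset.sum_mul]
      refine Finset.sum_congr rfl fun j _ => Finset.sum_congr rfl fun i _ => ?_
      rw [variation, slope, mul_assoc]
    change _ ∣ ∑ a : Fin 2 × Fin q,
        Polynomial.C ((w a.1 (E (Sum.inr a.2))).snd) * variation F' a
    rw [← h6, ← h3, h1, map_mul, map_prod]
    simp only [map_pow]
    refine dvd_trans ?_ (prod_fst_pow_dvd_snd _ _ _ _)
    refine Finset.prod_dvd_prod_of_dvd _ _ fun j _ => pow_dvd_pow_of_dvd ?_ _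
    refine ⟨Polynomial.C (L j 0).fst, ?_⟩
    have h7 : Polynomial.C (-(L j 1).fst / (L j 0).fst) * Polynomial.C (L j 0).fst =
        -Polynomial.C (L j 1).fst := by
      rw [← Polynomial.C_mul, div_mul_cancel₀ _ (hL0 j), Polynomial.C_neg]
    rw [sub_mul, h7, dehomogenizeDual_linForm, TrivSqZeroExt.fst_add, TrivSqZeroExt.fst_inl,
      TrivSqZeroExt.fst_inr, Fin.sum_univ_two, Matrix.cons_val_zero, Matrix.cons_val_one,
      Matrix.cons_val_fin_one]
    ring

end Chart

/-! ### The hypersurface of forms with a bad frame -/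

section Hypersurface

variable {K W : Type*} [Field K] {F : MvPolynomial W K} {k : ℕ} {m : Fin k → ℕ}

theorem BadFrame.C_mul {w : Matrix (Fin 2) W (DualNumber K)} (h : BadFrame F m w) {a : K}
    (ha : a ≠ 0) : BadFrame (MvPolynomial.C a * F) m w := by
  obtain ⟨hc, ⟨c, L, hL⟩, hne⟩ := h
  refine ⟨hc, ⟨algebraMap K _ a * c, L, ?_⟩, ?_⟩
  · rw [pullForm, map_mul, MvPolynomial.algHom_C, ← pullForm, hL, MvPolynomial.C_mul, mul_assoc]
    rfl
  · rw [pullForm, map_mul, MvPolynomial.algHom_C, ← pullForm]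
    refine mul_ne_zero ?_ hne
    rw [MvPolynomial.algebraMap_eq]
    simpa using ha

/-- Finitely many binary linear forms that do not vanish identically are nonzero at some point
`(1, n)` with `n` a natural number bounded by the number of forms. -/
theorem exists_nat_forall_add_ne_zero [CharZero K] {d : ℕ} (hk : k ≤ d) (a : Fin k → Fin 2 → K)
    (ha : ∀ j, a j ≠ 0) : ∃ n : Fin (d + 1), ∀ j, a j 0 + (n : K) * a j 1 ≠ 0 := by
  classical
  let p : Fin k → Polynomial K := fun j => Polynomial.C (a j 0) + Polynomial.X *
    Polynomial.C (a j 1)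
  have hp : ∀ j, p j ≠ 0 := by
    intro j h0
    apply ha j
    funext i
    fin_cases i
    · simpa [p] using congrArg (fun q => Polynomial.coeff q 0) h0
    · simpa [p] using congrArg (fun q => Polynomial.coeff q 1) h0
  have hdeg : (∏ j, p j).natDegree ≤ k := by
    refine (Polynomial.natDegree_prod_le _ _).trans ?_
    refine (Finset.sum_le_sum (g := fun _ => 1) fun j _ => ?_).trans (by simp)
    refine Polynomial.natDegree_add_le_of_degree_le (by simp) ?_
    refine Polynomial.natDegree_mul_le.trans ?_
    simp
  obtain ⟨n, hn⟩ : ∃ n : Fin (d + 1), (∏ j, p j).eval (n : K) ≠ 0 := by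
    by_contra! hall
    apply Finset.prod_ne_zero_iff.mpr (fun j _ => hp j)
    refine Polynomial.eq_zero_of_natDegree_lt_card_of_eval_eq_zero (∏ j, p j)
      (f := fun n : Fin (d + 1) => (n : K)) ?_ hall ?_
    · exact fun x y h => Fin.ext (Nat.cast_injective h)
    · rw [Fintype.card_fin]
      omega
  refine ⟨n, fun j h0 => hn ?_⟩
  rw [Polynomial.eval_prod]
  rw [mul_comm] at h0
  exact Finset.prod_eq_zero (Finset.mem_univ j) (by simpa [p] using h0)

/-- A form with a bad frame is bad in one of finitely many charts, with one of finitely many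
choices of a point at infinity. -/
theorem BadFrame.exists_isChartBad [CharZero K] {q d : ℕ} (E₀ : Fin 2 ⊕ Fin q ≃ W) (hk : k ≤ d)
    (hpos : ∀ j, 0 < m j) {w : Matrix (Fin 2) W (DualNumber K)} (h : BadFrame F m w)
    {l : Fin 2 → W} (hl : (w.submatrix id l).det.fst ≠ 0) :
    ∃ (E : Fin 2 ⊕ Fin q ≃ W) (n : Fin (d + 1)) (y : Fin 2 × Fin q → K),
      IsChartBad (MvPolynomial.aeval (chartSubstInv E (n : K) y) F) m := by
  have hinj : Function.Injective l := by
    have h01 : l 0 ≠ l 1 := fun h01 => hl (by simp [Matrix.det_fin_two, h01])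
    intro i j hij
    fin_cases i <;> fin_cases j
    · rfl
    · exact absurd hij h01
    · exact absurd hij.symm h01
    · rfl
  obtain ⟨E, hE⟩ := exists_equiv_of_injective E₀ l hinj
  have hunit : IsUnit (w.submatrix id l).det :=
    TrivSqZeroExt.isUnit_iff_isUnit_fst.mpr (isUnit_iff_ne_zero.mpr hl)
  let M : GL (Fin 2) (DualNumber K) := Matrix.nonsingInvUnit (w.submatrix id l) hunit
  -- a change of frame makes the minor with columns `l` the identity
  let w₁ := M⁻¹.val * w
  have h₁ : BadFrame F m w₁ := h.mul M⁻¹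
  have hw₁ : w₁.submatrix id l = 1 := by
    change M⁻¹.val * M.val = 1
    rw [← Units.val_mul, inv_mul_cancel, Units.val_one]
  obtain ⟨c, L, hL⟩ := h₁.factor
  have hL0 : ∀ j, (fun i => (L j i).fst) ≠ 0 := by
    intro j h0
    apply h₁.ne_zero
    rw [← map_fst_pullForm, hL, map_mul, map_prod, Finset.prod_eq_zero (Finset.mem_univ j),
      mul_zero]
    rw [map_pow, map_linForm]
    have h0' : (fun i => (TrivSqZeroExt.fstHom K K K : DualNumber K →+* K) (L j i)) = 0 := h0
    rw [h0']
    simp [linForm, (hpos j).ne']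
  obtain ⟨n, hn⟩ := exists_nat_forall_add_ne_zero hk _ hL0
  -- a further change of frame moves `[1 : n]`, which is not a root, to infinity `[1 : 0]`
  let N : Matrix (Fin 2) (Fin 2) (DualNumber K) := !![1, (n : DualNumber K); 0, 1]
  let g : GL (Fin 2) (DualNumber K) := Matrix.nonsingInvUnit N.transpose (by simp [N])
  let G : GL (Fin 2) (DualNumber K) := Matrix.nonsingInvUnit N (by simp [N])
  have hfr : (N * w₁).submatrix id l = N := by
    change N * w₁.submatrix id l = N
    rw [hw₁, Matrix.mul_one]
  have hent : ∀ i i', (N * w₁) i (E (Sum.inl i')) = N i i' := fun i i' => by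
    rw [hE]
    exact congrFun (congrFun hfr i) i'
  refine ⟨E, n, _, isChartBad_of_frame E (n : K) (N * w₁) ?_ ?_ ?_ ?_ (h₁.mul G).not_const c
    (fun j => Matrix.vecMul (L j) g.val) ?_ ?_⟩
  · simp [hent, N]
  · rw [hent]
    change ((n : ℕ) : DualNumber K) = _
    rw [TrivSqZeroExt.inl_natCast]
  · simp [hent, N]
  · simp [hent, N]
  · have h2 := changeCoord_pullForm g F w₁
    rw [show g.val.transpose = N from Matrix.transpose_transpose N] at h2
    rw [← h2, hL, changeCoord_mul, changeCoord_C, changeCoord_prod]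
    simp only [changeCoord_pow, changeCoord_linForm]
  · intro j
    have h2 : Matrix.vecMul (L j) g.val 0 = L j 0 + n * L j 1 := by
      change Matrix.vecMul (L j) N.transpose 0 = _
      simp [Matrix.vecMul, dotProduct, N, Fin.sum_univ_two, mul_comm]
    rw [h2]
    simpa using hn j

/-- The forms of degree `d` with a bad frame, for any multiplicities `m` on `k = d - 2q` points, lie
in a hypersurface. -/
theorem exists_hypersurface_of_badFrame [CharZero K] {q d : ℕ} (E₀ : Fin 2 ⊕ Fin q ≃ W)
    (hqk : 2 * q + k = d) :
    ∃ (n : ℕ) (Φ : MvPolynomial {α : W →₀ ℕ // α.degree = d} K), Φ ≠ 0 ∧ Φ.IsHomogeneous n ∧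
      ∀ (F : MvPolynomial W K) (m : Fin k → ℕ) (w : Matrix (Fin 2) W (DualNumber K))
        (l : Fin 2 → W), F.IsHomogeneous d → (∀ j, 0 < m j) → ∑ j, m j = d → BadFrame F m w →
        (w.submatrix id l).det.fst ≠ 0 →
        MvPolynomial.eval (fun α => MvPolynomial.coeff α.val F) Φ = 0 := by
  classical
  have hfin : Finite W := Finite.of_equiv _ E₀
  have : Fintype W := Fintype.ofFinite W
  have hchart : ∀ i : (Fin 2 ⊕ Fin q ≃ W) × Fin (d + 1) × (Fin k → Fin (d + 1)),
      ∃ Φ : MvPolynomial {α : W →₀ ℕ // α.degree = d} K, Φ ≠ 0 ∧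
        ((∀ j, 0 < (i.2.2 j : ℕ)) → ∑ j, (i.2.2 j : ℕ) = d →
          ∀ (F : MvPolynomial W K) (y : Fin 2 × Fin q → K), F.IsHomogeneous d →
            IsChartBad (MvPolynomial.aeval (chartSubstInv i.1 ((i.2.1 : ℕ) : K) y) F)
              (fun j => (i.2.2 j : ℕ)) →
            MvPolynomial.eval (fun α => MvPolynomial.coeff α.val F) Φ = 0) := by
    rintro ⟨E, n, m⟩
    by_cases hm : (∀ j, 0 < (m j : ℕ)) ∧ ∑ j, (m j : ℕ) = d
    · obtain ⟨hpos, hsum⟩ := hm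
      have hsum' : ∑ j, ((m j : ℕ) - 1) = 2 * q := by
        have h1 := sum_sub_one_add hpos
        omega
      obtain ⟨Φ, hΦ, h⟩ := exists_hypersurface_of_chart (K := K) (m := fun j => (m j : ℕ)) hsum
        hpos hsum' E (chartSubst E (MvPolynomial.C ((n : ℕ) : K)) MvPolynomial.X)
      refine ⟨Φ, hΦ, fun _ _ F y hF hbad => ?_⟩
      have h1 := h _ y (isHomogeneous_aeval_chartSubstInv E _ y hF) hbad
      have h2 : (fun v => MvPolynomial.map (MvPolynomial.eval y)
          (chartSubst E (MvPolynomial.C ((n : ℕ) : K)) MvPolynomial.X v)) =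
          chartSubst E ((n : ℕ) : K) y := by
        funext v
        rw [map_chartSubst, MvPolynomial.eval_C]
        congr 1
        funext a
        exact MvPolynomial.eval_X a
      rwa [h2, aeval_chartSubst_chartSubstInv] at h1
    · exact ⟨1, one_ne_zero, fun hpos hsum => absurd ⟨hpos, hsum⟩ hm⟩
  choose Ψ hΨ0 hΨ using hchart
  let S : Set ({α : W →₀ ℕ // α.degree = d} → K) := {x | ∃ (F : MvPolynomial W K)
    (m : Fin k → ℕ) (w : Matrix (Fin 2) W (DualNumber K)) (l : Fin 2 → W),
    (F.IsHomogeneous d ∧ (∀ j, 0 < m j) ∧ ∑ j, m j = d ∧ BadFrame F m w ∧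
      (w.submatrix id l).det.fst ≠ 0) ∧ x = fun α => MvPolynomial.coeff α.val F}
  have hcone : ∀ x ∈ S, ∀ a : K, a ≠ 0 → a • x ∈ S := by
    rintro _ ⟨F, m, w, l, ⟨hF, hpos, hsum, hbad, hl⟩, rfl⟩ a ha
    refine ⟨MvPolynomial.C a * F, m, w, l, ⟨?_, hpos, hsum, hbad.C_mul ha, hl⟩, ?_⟩
    · simpa using (MvPolynomial.isHomogeneous_C _ a).mul hF
    · funext α
      simp
  have hzero : ∀ x ∈ S, MvPolynomial.eval x (∏ i, Ψ i) = 0 := by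
    rintro _ ⟨F, m, w, l, ⟨hF, hpos, hsum, hbad, hl⟩, rfl⟩
    obtain ⟨E, n, y, hy⟩ := hbad.exists_isChartBad E₀ (d := d) (by omega) hpos hl
    have hmd : ∀ j, m j < d + 1 := fun j => Nat.lt_succ_of_le
      (hsum ▸ Finset.single_le_sum (fun _ _ => Nat.zero_le _) (Finset.mem_univ j))
    rw [map_prod]
    exact Finset.prod_eq_zero (Finset.mem_univ (E, n, fun j => ⟨m j, hmd j⟩))
      (hΨ (E, n, fun j => ⟨m j, hmd j⟩) hpos hsum F y hF hy)
  obtain ⟨n, Φ, hΦ0, hΦn, hΦ⟩ := exists_isHomogeneous_of_cone S hcone (∏ i, Ψ i)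
    (Finset.prod_ne_zero_iff.mpr fun i _ => hΨ0 i) hzero
  exact ⟨n, Φ, hΦ0, hΦn, fun F m w l hF hpos hsum hbad hl =>
    hΦ _ ⟨F, m, w, l, ⟨hF, hpos, hsum, hbad, hl⟩, rfl⟩⟩

end Hypersurface

/-! ### Factorization of binary forms -/

section BinaryForm

variable {K : Type*} [Field K]

/-- The change of coordinates that moves the point `[1 : γ]` to `[1 : 0]`. -/
def lowerShift (γ : K) : GL (Fin 2) K :=
  ⟨!![1, 0; γ, 1], !![1, 0; -γ, 1], by simp [Matrix.one_fin_two], by simp [Matrix.one_fin_two]⟩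

theorem eval_changeCoord_lowerShift (γ : K) (f : MvPolynomial (Fin 2) K) :
    MvPolynomial.eval ![1, 0] (changeCoord (lowerShift γ) f) = MvPolynomial.eval ![1, γ] f := by
  rw [← MvPolynomial.coe_aeval_eq_eval, ← MvPolynomial.coe_aeval_eq_eval, changeCoord]
  change MvPolynomial.aeval ![1, 0] _ = MvPolynomial.aeval ![1, γ] f
  rw [← AlgHom.comp_apply, MvPolynomial.comp_aeval]
  congr 2
  funext i
  fin_cases i <;> simp [lowerShift]

theorem changeCoord_lowerShift_inv (γ a : K) :
    changeCoord (lowerShift γ)⁻¹ (MvPolynomial.X 0 - MvPolynomial.C a * MvPolynomial.X 1) =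
      MvPolynomial.C (1 + a * γ) * MvPolynomial.X 0 - MvPolynomial.C a * MvPolynomial.X 1 := by
  have h : (lowerShift γ)⁻¹.val = !![1, 0; -γ, 1] := rfl
  have hs : ∀ P Q : MvPolynomial (Fin 2) K, changeCoord (lowerShift γ)⁻¹ (P - Q) =
    changeCoord (lowerShift γ)⁻¹ P - changeCoord (lowerShift γ)⁻¹ Q := fun P Q => map_sub _ _ _
  rw [hs, changeCoord_mul, changeCoord_C, changeCoord_X, changeCoord_X, h]
  simp
  ring

theorem exists_eval_one_ne_zero [Infinite K] {f : MvPolynomial (Fin 2) K} {d : ℕ}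
    (hf : f.IsHomogeneous d) (hne : f ≠ 0) : ∃ γ : K, MvPolynomial.eval ![1, γ] f ≠ 0 := by
  obtain ⟨x, hx⟩ : ∃ x, MvPolynomial.eval x (f * MvPolynomial.X 0) ≠ 0 := by
    by_contra! h
    exact mul_ne_zero hne (MvPolynomial.X_ne_zero 0)
      (MvPolynomial.funext fun x => by simpa using h x)
  rw [map_mul, MvPolynomial.eval_X] at hx
  have hx0 : x 0 ≠ 0 := right_ne_zero_of_mul hx
  refine ⟨x 1 / x 0, fun h => left_ne_zero_of_mul hx ?_⟩
  have h1 : x = x 0 • ![1, x 1 / x 0] := by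
    funext i
    fin_cases i
    · simp
    · simp [mul_div_cancel₀ _ hx0]
  rw [h1, eval_smul_of_isHomogeneous hf, h, mul_zero]

/-- Over an algebraically closed field a binary form is a product of linear forms; after moving a
nonzero of the form to infinity, these are monic in `s`. -/
theorem exists_factorization [IsAlgClosed K] {f : MvPolynomial (Fin 2) K} {d : ℕ}
    (hf : f.IsHomogeneous d) (hne : f ≠ 0) :
    ∃ (n : ℕ) (m : Fin n → ℕ) (α : Fin n → K) (γ c : K), Function.Injective α ∧ c ≠ 0 ∧
      (∀ j, 0 < m j) ∧ ∑ j, m j = d ∧ changeCoord (lowerShift γ) f = MvPolynomial.C c *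
        ∏ j, (MvPolynomial.X 0 - MvPolynomial.C (α j) * MvPolynomial.X 1) ^ m j := by
  classical
  have : Infinite K := IsAlgClosed.instInfinite
  obtain ⟨γ, hγ⟩ := exists_eval_one_ne_zero hf hne
  rw [← eval_changeCoord_lowerShift] at hγ
  have hg := isHomogeneous_changeCoord (lowerShift γ) hf
  generalize hgf : changeCoord (lowerShift γ) f = g at hγ hg
  let p : Polynomial K := MvPolynomial.aeval ![Polynomial.X, 1] g
  have hpg : p.homogenize d = g := Polynomial.homogenize_eq_of_isHomogeneous hg rfl
  have hp0 : p ≠ 0 := by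
    intro h
    rw [h, Polynomial.homogenize_zero] at hpg
    rw [← hpg, map_zero] at hγ
    exact hγ rfl
  have hpd : p.natDegree ≤ d := by
    have h1 := MvPolynomial.aeval_natDegree_le g hg.totalDegree_le ![Polynomial.X, 1] (n := 1)
      (by intro i; fin_cases i <;> simp)
    rwa [mul_one] at h1
  let e := p.roots.toFinset.equivFin.symm
  let α : Fin p.roots.toFinset.card → K := fun j => e j
  let m : Fin p.roots.toFinset.card → ℕ := fun j => p.rootMultiplicity (α j)
  have hα : Function.Injective α := Subtype.val_injective.comp e.injective
  have hm : ∀ j, 0 < m j := fun j => by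
    have h1 : α j ∈ p.roots := Multiset.mem_toFinset.mp (e j).property
    exact (Polynomial.rootMultiplicity_pos hp0).mpr (Polynomial.isRoot_of_mem_roots h1)
  have hfac : p = Polynomial.C p.leadingCoeff *
      ∏ j, (Polynomial.X - Polynomial.C (α j)) ^ m j := by
    conv_lhs => rw [(IsAlgClosed.splits p).eq_prod_roots]
    rw [Polynomial.prod_multiset_root_eq_finset_root]
    congr 1
    rw [← Finset.prod_coe_sort]
    exact (Equiv.prod_comp e _).symm
  have hsum : ∑ j, m j ≤ d := by
    refine le_trans (le_of_eq ?_) hpd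
    conv_rhs => rw [hfac, Polynomial.natDegree_C_mul (Polynomial.leadingCoeff_ne_zero.mpr hp0),
      Polynomial.natDegree_prod_of_monic _ _ fun j _ => (Polynomial.monic_X_sub_C _).pow _]
    simp only [Polynomial.natDegree_pow, Polynomial.natDegree_X_sub_C, mul_one]
  let Q : MvPolynomial (Fin 2) K := MvPolynomial.C p.leadingCoeff *
    ∏ j, (MvPolynomial.X 0 - MvPolynomial.C (α j) * MvPolynomial.X 1) ^ m j
  have hlin : ∀ a : K, (MvPolynomial.X 0 - MvPolynomial.C a * MvPolynomial.X 1 :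
      MvPolynomial (Fin 2) K).IsHomogeneous 1 := fun a => by
    refine (MvPolynomial.isHomogeneous_X K 0).sub ?_
    simpa using (MvPolynomial.isHomogeneous_C (Fin 2) a).mul (MvPolynomial.isHomogeneous_X K 1)
  have hQ : (Q * MvPolynomial.X 1 ^ (d - ∑ j, m j)).IsHomogeneous d := by
    have h1 := ((MvPolynomial.isHomogeneous_C (Fin 2) p.leadingCoeff).mul
      (MvPolynomial.IsHomogeneous.prod Finset.univ _ _ fun j _ => (hlin (α j)).pow (m j))).mul
      ((MvPolynomial.isHomogeneous_X K (1 : Fin 2)).pow (d - ∑ j, m j))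
    simp only [one_mul, zero_add] at h1
    rwa [Nat.add_sub_cancel' hsum] at h1
  have hgQ : g = Q * MvPolynomial.X 1 ^ (d - ∑ j, m j) := by
    rw [← hpg]
    refine Polynomial.homogenize_eq_of_isHomogeneous hQ ?_
    conv_rhs => rw [hfac]
    simp [Q]
  have hd : d - ∑ j, m j = 0 := by
    by_contra h
    apply hγ
    rw [hgQ]
    simp [h]
  rw [hd, pow_zero, mul_one] at hgQ
  exact ⟨_, m, α, γ, p.leadingCoeff, hα, Polynomial.leadingCoeff_ne_zero.mpr hp0, hm,
    by omega, hgf.trans hgQ⟩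

/-- The point `[a : 1 + a γ]`, which `lowerShift γ` moves to `[a : 1]`. -/
def rootPoint (γ a : K) : ℙ K (Fin 2 → K) :=
  Projectivization.mk K ![a, 1 + a * γ] fun h => by
    have h0 : a = 0 := congrFun h 0
    have h1 : 1 + a * γ = 0 := congrFun h 1
    simp [h0] at h1

theorem rootPoint_injective (γ : K) : Function.Injective (rootPoint γ) := by
  intro a a' h
  obtain ⟨x, hx⟩ := (Projectivization.mk_eq_mk_iff' K _ _ _ _).mp h
  have h0 : x * a' = a := congrFun hx 0
  have h1 : x * (1 + a' * γ) = 1 + a * γ := congrFun hx 1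
  have h2 : x = 1 := by linear_combination h1 - γ * h0
  rw [← h0, h2, one_mul]

theorem eval_rep_eq_zero_iff {τ : Type*} {f : MvPolynomial τ K} {d : ℕ} (hf : f.IsHomogeneous d)
    (v : τ → K) (hv : v ≠ 0) :
    MvPolynomial.eval (Projectivization.mk K v hv).rep f = 0 ↔ MvPolynomial.eval v f = 0 := by
  obtain ⟨a, ha⟩ := Projectivization.exists_smul_eq_mk_rep K v hv
  rw [← ha, Units.smul_def, eval_smul_of_isHomogeneous hf]
  simp

theorem zeros_eq_range_rootPoint {f : MvPolynomial (Fin 2) K} {n : ℕ} {m : Fin n → ℕ}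
    (hm : ∀ j, 0 < m j) {α : Fin n → K} {γ c : K} (hc : c ≠ 0)
    (hf : f = MvPolynomial.C c * ∏ j, (MvPolynomial.C (1 + α j * γ) * MvPolynomial.X 0 -
      MvPolynomial.C (α j) * MvPolynomial.X 1) ^ m j) :
    {p : ℙ K (Fin 2 → K) | MvPolynomial.eval p.rep f = 0} =
      Set.range fun j => rootPoint γ (α j) := by
  ext p
  simp only [Set.mem_ofPred_eq, Set.mem_range]
  rw [hf, map_mul, MvPolynomial.eval_C, mul_eq_zero_iff_left hc, map_prod, Finset.prod_eq_zero_iff]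
  refine exists_congr fun j => ?_
  simp only [Finset.mem_univ, true_and, map_pow, pow_eq_zero_iff (hm j).ne', map_sub, map_mul,
    MvPolynomial.eval_C, MvPolynomial.eval_X]
  constructor
  · intro h
    rw [← Projectivization.mk_rep p]
    refine ((Projectivization.mk_eq_mk_iff' K _ _ _ _).mpr
      ⟨p.rep 1 - γ * p.rep 0, ?_⟩).symm
    funext i
    fin_cases i
    · simp
      linear_combination -h
    · simp
      linear_combination -γ * h
  · rintro rfl
    obtain ⟨a, ha⟩ := Projectivization.exists_smul_eq_mk_rep K ![α j, 1 + α j * γ] _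
    rw [rootPoint, ← ha]
    simp [Units.smul_def]
    ring

/-- The points and multiplicities of the divisor in `ℙ¹` defined by a binary form. -/
theorem exists_eq_prod_rep {f : MvPolynomial (Fin 2) K} {n : ℕ} {m : Fin n → ℕ}
    {α : Fin n → K} (hα : Function.Injective α) {γ c : K} (hc : c ≠ 0)
    (hf : f = MvPolynomial.C c * ∏ j, (MvPolynomial.C (1 + α j * γ) * MvPolynomial.X 0 -
      MvPolynomial.C (α j) * MvPolynomial.X 1) ^ m j) :
    ∃ (p : Fin n → ℙ K (Fin 2 → K)) (c' : K), Function.Injective p ∧ c' ≠ 0 ∧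
      f = MvPolynomial.C c' * ∏ j, (MvPolynomial.C ((p j).rep 1) * MvPolynomial.X 0 -
        MvPolynomial.C ((p j).rep 0) * MvPolynomial.X 1) ^ m j := by
  choose a ha using fun j =>
    Projectivization.exists_smul_eq_mk_rep K ![α j, 1 + α j * γ] (show _ ≠ 0 from fun h => by
      have h0 : α j = 0 := congrFun h 0
      have h1 : 1 + α j * γ = 0 := congrFun h 1
      simp [h0] at h1)
  have h0 : ∀ j, (rootPoint γ (α j)).rep 0 = a j * α j := fun j => (congrFun (ha j) 0).symm
  have h1 : ∀ j, (rootPoint γ (α j)).rep 1 = a j * (1 + α j * γ) := fun j =>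
    (congrFun (ha j) 1).symm
  have hne : ∏ j, (a j : K) ^ m j ≠ 0 :=
    Finset.prod_ne_zero_iff.mpr fun j _ => pow_ne_zero _ (a j).ne_zero
  refine ⟨fun j => rootPoint γ (α j), c * (∏ j, (a j : K) ^ m j)⁻¹,
    (rootPoint_injective γ).comp hα, mul_ne_zero hc (inv_ne_zero hne), ?_⟩
  have h2 : ∀ j, (MvPolynomial.C ((rootPoint γ (α j)).rep 1) * MvPolynomial.X 0 -
      MvPolynomial.C ((rootPoint γ (α j)).rep 0) * MvPolynomial.X 1 : MvPolynomial (Fin 2) K) =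
      MvPolynomial.C (a j : K) * (MvPolynomial.C (1 + α j * γ) * MvPolynomial.X 0 -
      MvPolynomial.C (α j) * MvPolynomial.X 1) := fun j => by
    rw [h0, h1, MvPolynomial.C_mul, MvPolynomial.C_mul]
    ring
  simp only [h2, mul_pow, Finset.prod_mul_distrib]
  rw [← mul_assoc, hf]
  congr 1
  simp only [← MvPolynomial.C_pow, ← map_prod, ← MvPolynomial.C_mul]
  rw [inv_mul_cancel_right₀ hne]

end BinaryForm

/-! ### Tangent vectors annihilated by an unfolding map -/

theorem unfolding_zero {A : Type*} [CommRing A] (n : ℕ) :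
    unfolding n (0 : Fin (n - 1) → A) = MvPolynomial.X 0 ^ n := by
  simp [unfolding]

theorem map_unfolding {A B : Type*} [CommRing A] [CommRing B] (φ : A →+* B) (n : ℕ)
    (a : Fin (n - 1) → A) : MvPolynomial.map φ (unfolding n a) = unfolding n (φ ∘ a) := by
  simp [unfolding]

/-- Along a morphism to the étale neighbourhood that an unfolding map contracts to the origin, the
family is, up to a unit, a product of powers of linear forms. -/
theorem IsUnfoldingMap.exists_map_eq {K R D : Type u} [Field K] [CommRing R] [Algebra K R]
    [CommRing D] {b : R →ₐ[K] K} {Z : MvPolynomial (Fin 2) R} {k : ℕ} {m : Fin k → ℕ}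
    {U : EtaleNbhd b} {μ : UnfoldingBase K m →ₐ[K] U.ring} (h : IsUnfoldingMap Z m U μ)
    (v : U.ring →+* D) (hv : ∀ i, v (μ (MvPolynomial.X i)) = 0) :
    ∃ (c : D) (L : Fin k → Fin 2 → D),
      MvPolynomial.map (v.comp (algebraMap R U.ring)) Z =
        MvPolynomial.C c * ∏ j, linForm (L j) ^ m j := by
  obtain ⟨-, Zc, ⟨c, hc⟩, -, hZ⟩ := h
  have hfac : ∀ j, ∃ (c' : D) (l : Fin 2 → D),
      MvPolynomial.map v (Zc j) = MvPolynomial.C c' * linForm l ^ m j := by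
    intro j
    obtain ⟨g, c', hg⟩ := hZ j
    have h1 := congrArg (MvPolynomial.map v) hg
    have h2 : (v ∘ fun i => μ (MvPolynomial.X ⟨j, i⟩)) = (0 : Fin (m j - 1) → D) :=
      funext fun i => hv ⟨j, i⟩
    have h3 : (MvPolynomial.X 0 : MvPolynomial (Fin 2) D) = linForm ![1, 0] := by
      simp [linForm]
    rw [map_changeCoord, map_mul, MvPolynomial.map_C, map_unfolding, h2, unfolding_zero, h3] at h1
    refine ⟨v c', Matrix.vecMul ![1, 0] (Matrix.GeneralLinearGroup.map v g)⁻¹.val, ?_⟩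
    rw [← changeCoord_inv_changeCoord (Matrix.GeneralLinearGroup.map v g)
      (MvPolynomial.map v (Zc j)), h1, changeCoord_mul, changeCoord_C, changeCoord_pow,
      changeCoord_linForm]
  choose c' l hl using hfac
  refine ⟨v c * ∏ j, c' j, l, ?_⟩
  rw [← MvPolynomial.map_map, hc, map_mul, MvPolynomial.map_C, map_prod]
  simp only [hl, Finset.prod_mul_distrib, ← map_prod]
  rw [MvPolynomial.C_mul, mul_assoc]

/-- The frame `e_i + ε ∑_j a_{i,j} e'_j`, in a chart of the Grassmannian, is constant up to a change
of frame only if `a = 0`. -/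
theorem eq_zero_of_frame_eq_mul_constFrame {K W ι : Type*} [Field K] [Fintype ι]
    (e : Module.Basis (Fin 2 ⊕ ι) K (W → K)) {w : Matrix (Fin 2) W (DualNumber K)}
    (a : Fin 2 → ι → K) (hfst : ∀ i, (fun l => (w i l).fst) = e (Sum.inl i))
    (hsnd : ∀ i, (fun l => (w i l).snd) = ∑ j, a i j • e (Sum.inr j))
    (H : Matrix (Fin 2) (Fin 2) (DualNumber K)) (x : Matrix (Fin 2) W K)
    (h : w = H * constFrame x) : a = 0 := by
  classical
  let H₀ : Matrix (Fin 2) (Fin 2) K := fun i i' => (H i i').fst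
  let H₁ : Matrix (Fin 2) (Fin 2) K := fun i i' => (H i i').snd
  let y : Matrix (Fin 2) (Fin 2) K := fun i i' => e.repr (x i) (Sum.inl i')
  have h0 : ∀ i, e (Sum.inl i) = ∑ i', H₀ i i' • x i' := by
    intro i
    rw [← hfst]
    funext l
    simp [h, Matrix.mul_apply, constFrame, H₀]
  have h1 : ∀ i, ∑ j, a i j • e (Sum.inr j) = ∑ i', H₁ i i' • x i' := by
    intro i
    rw [← hsnd]
    funext l
    simp [h, Matrix.mul_apply, constFrame, H₁]
  have hy0 : H₀ * y = 1 := by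
    ext i i'
    have h2 := congrArg (fun z => e.repr z (Sum.inl i')) (h0 i)
    simp only [Module.Basis.repr_self, map_sum, map_smul, Finsupp.coe_finsetSum, Finset.sum_apply,
      Finsupp.smul_apply, smul_eq_mul, Finsupp.single_apply, Sum.inl.injEq] at h2
    rw [Matrix.mul_apply, Matrix.one_apply]
    exact h2.symm
  have hy1 : H₁ * y = 0 := by
    ext i i'
    have h2 := congrArg (fun z => e.repr z (Sum.inl i')) (h1 i)
    simp only [Module.Basis.repr_self, map_sum, map_smul, Finsupp.coe_finsetSum, Finset.sum_apply,
      Finsupp.smul_apply, smul_eq_mul, Finsupp.single_apply, reduceCtorEq, if_false, mul_zero,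
      Finset.sum_const_zero] at h2
    rw [Matrix.mul_apply, Matrix.zero_apply]
    exact h2.symm
  have hH : H₁ = 0 := by
    rw [← Matrix.mul_one H₁, ← mul_eq_one_comm.mp hy0, ← Matrix.mul_assoc, hy1, Matrix.zero_mul]
  funext i j
  have h2 := congrArg (fun z => e.repr z (Sum.inr j)) (h1 i)
  simpa [hH, Finsupp.single_apply] using h2

theorem exists_det_submatrix_ne_zero {K W : Type*} [Field K] {x : Matrix (Fin 2) W K}
    (hx : LinearIndependent K x) : ∃ l : Fin 2 → W, (x.submatrix id l).det ≠ 0 := by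
  by_contra! h
  have h0 : x 0 = 0 := by
    funext l
    refine Fintype.linearIndependent_iff.mp hx ![-x 1 l, x 0 l] ?_ 1
    funext l'
    have h1 := h ![l, l']
    rw [Matrix.det_fin_two] at h1
    simp only [Matrix.submatrix_apply, id, Matrix.cons_val_zero, Matrix.cons_val_one,
      Matrix.cons_val_fin_one] at h1
    simp only [Fin.sum_univ_two, Matrix.cons_val_zero, Matrix.cons_val_one,
      Matrix.cons_val_fin_one, Pi.add_apply, Pi.smul_apply, smul_eq_mul, Pi.zero_apply]
    linear_combination h1
  exact hx.ne_zero 0 h0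

/-! ### Versality of the point-line correspondence -/

section Line

variable {K : Type u} [Field K] {r : ℕ}

theorem incidenceForm_eq_pullForm (F : MvPolynomial (Fin (r + 1)) K)
    (e : Module.Basis (Fin 2 ⊕ Fin (r - 1)) K (Fin (r + 1) → K)) :
    incidenceForm F e = pullForm F (Matrix.of (tautFrame e)) := rfl

theorem isHomogeneous_pullForm {A W : Type*} [CommRing A] [Algebra K A] {F : MvPolynomial W K}
    {d : ℕ} (hF : F.IsHomogeneous d) (w : Matrix (Fin 2) W A) :
    (pullForm F w).IsHomogeneous d := by
  have h := hF.aeval (fun l => linForm fun i => w i l) (n := 1) fun l =>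
    MvPolynomial.IsHomogeneous.sum Finset.univ _ _ fun i _ => by
      simpa using (MvPolynomial.isHomogeneous_C (Fin 2) (w i l)).mul
        (MvPolynomial.isHomogeneous_X A i)
  rwa [one_mul] at h

theorem map_chartCentre_incidenceForm (F : MvPolynomial (Fin (r + 1)) K)
    (e : Module.Basis (Fin 2 ⊕ Fin (r - 1)) K (Fin (r + 1) → K)) :
    MvPolynomial.map (chartCentre K r).toRingHom (incidenceForm F e) =
      pullForm F (Matrix.of fun i => e (Sum.inl i)) := by
  rw [incidenceForm_eq_pullForm]
  refine (map_pullForm (chartCentre K r) F _).trans ?_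
  congr 1
  ext i l
  simp [tautFrame, chartCentre]

/-- If the hypersurface has no bad frames, then an unfolding map annihilates no nonzero tangent
vector. -/
theorem snd_eq_zero_of_tangent {F : MvPolynomial (Fin (r + 1)) K}
    {e : Module.Basis (Fin 2 ⊕ Fin (r - 1)) K (Fin (r + 1) → K)} {k : ℕ} {m : Fin k → ℕ}
    (hF : ∀ (w : Matrix (Fin 2) (Fin (r + 1)) (DualNumber K)) (l : Fin 2 → Fin (r + 1)),
      (w.submatrix id l).det.fst ≠ 0 → ¬BadFrame F m w)
    (hne : pullForm F (Matrix.of fun i => e (Sum.inl i)) ≠ 0) {U : EtaleNbhd (chartCentre K r)}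
    {μ : UnfoldingBase K m →ₐ[K] U.ring} (h : IsUnfoldingMap (incidenceForm F e) m U μ)
    (v : TangentSpace U.point) (hv : ∀ i, (v.val (μ (MvPolynomial.X i))).snd = 0)
    (i : Fin 2 × Fin (r - 1)) :
    (v.val (algebraMap (ChartRing K r) U.ring (MvPolynomial.X i))).snd = 0 := by
  let ψ : ChartRing K r →ₐ[K] DualNumber K :=
    v.val.comp (IsScalarTower.toAlgHom K (ChartRing K r) U.ring)
  have hψ : ∀ i, (ψ (MvPolynomial.X i)).fst = 0 := fun i => by
    refine (TangentSpace.fst_apply v _).trans ((U.point_over _).trans ?_)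
    rw [chartCentre, MvPolynomial.aeval_X]
  let a : Fin 2 → Fin (r - 1) → K := fun i j => (ψ (MvPolynomial.X (i, j))).snd
  suffices ha : a = 0 from congrFun (congrFun ha i.1) i.2
  let w : Matrix (Fin 2) (Fin (r + 1)) (DualNumber K) := (Matrix.of (tautFrame e)).map ψ
  have hC : ∀ x : K, ψ (MvPolynomial.C x) = TrivSqZeroExt.inl x := fun x => ψ.commutes x
  have hfst : ∀ i, (fun l => (w i l).fst) = e (Sum.inl i) := by
    intro i
    funext l
    simp [w, tautFrame, hC, hψ, TrivSqZeroExt.fst_sum]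
  have hsnd : ∀ i, (fun l => (w i l).snd) = ∑ j, a i j • e (Sum.inr j) := by
    intro i
    funext l
    simp [w, tautFrame, hC, a, TrivSqZeroExt.snd_sum]
  have hwfst : w.map TrivSqZeroExt.fst = Matrix.of fun i => e (Sum.inl i) := by
    ext i l
    exact congrFun (hfst i) l
  have hμ : ∀ i, v.val (μ (MvPolynomial.X i)) = 0 := fun i => by
    refine TrivSqZeroExt.ext ?_ (hv i)
    rw [TangentSpace.fst_apply, ← AlgHom.comp_apply, h.1, unfoldingOrigin, MvPolynomial.aeval_X]
    rfl
  obtain ⟨c, L, hL⟩ := h.exists_map_eq v.val.toRingHom hμ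
  obtain ⟨l, hl⟩ := exists_det_submatrix_ne_zero
    (x := Matrix.of fun i => e (Sum.inl i)) (e.linearIndependent.comp _ Sum.inl_injective)
  by_contra ha
  refine hF w l ?_ ⟨fun H x hw => ha (eq_zero_of_frame_eq_mul_constFrame e a hfst hsnd H x hw),
    ⟨c, L, ?_⟩, by rwa [hwfst]⟩
  · rw [← hwfst] at hl
    rw [Matrix.det_fin_two] at hl ⊢
    simpa using hl
  · rw [← hL, incidenceForm_eq_pullForm]
    exact (map_pullForm ψ F _).symm

theorem eval_pullForm {W : Type*} (F : MvPolynomial W K) (x : Matrix (Fin 2) W K) (a : Fin 2 → K) :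
    MvPolynomial.eval a (pullForm F x) = MvPolynomial.eval (Matrix.vecMul a x) F := by
  rw [← MvPolynomial.coe_aeval_eq_eval, ← MvPolynomial.coe_aeval_eq_eval]
  change MvPolynomial.aeval a (pullForm F x) = MvPolynomial.aeval (Matrix.vecMul a x) F
  rw [pullForm, ← AlgHom.comp_apply, MvPolynomial.comp_aeval]
  congr 2
  funext l
  simp [linForm, Matrix.vecMul, dotProduct, mul_comm]

/-- The points of a line on the hypersurface correspond to the zeros in `ℙ¹` of the restriction of
the equation to the line. -/
theorem encard_zeros_pullForm {F : MvPolynomial (Fin (r + 1)) K} {d : ℕ} (hF : F.IsHomogeneous d)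
    {k : ℕ} {L : Line K r} (hL : IsIncident F k L)
    {e : Module.Basis (Fin 2 ⊕ Fin (r - 1)) K (Fin (r + 1) → K)} (he : IsAdapted L e) :
    {p : ℙ K (Fin 2 → K) | MvPolynomial.eval p.rep
      (pullForm F (Matrix.of fun i => e (Sum.inl i))) = 0}.encard = k := by
  let x : Matrix (Fin 2) (Fin (r + 1)) K := Matrix.of fun i => e (Sum.inl i)
  have hinj : Function.Injective x.vecMulLinear :=
    Matrix.vecMul_injective_iff.mpr (e.linearIndependent.comp _ Sum.inl_injective)
  have hrange : LinearMap.range x.vecMulLinear = L.val := by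
    rw [he, range_vecMulLinear]
    congr 1
    ext y
    constructor
    · rintro ⟨i, rfl⟩
      fin_cases i
      · exact Or.inl rfl
      · exact Or.inr rfl
    · rintro (rfl | rfl)
      · exact ⟨0, rfl⟩
      · exact ⟨1, rfl⟩
  rw [← hL, ← (Projectivization.map_injective x.vecMulLinear hinj).encard_image]
  congr 1
  have hx := isHomogeneous_pullForm hF x
  ext p
  simp only [Set.mem_image, Set.mem_ofPred_eq]
  constructor
  · rintro ⟨q, hq, rfl⟩
    induction q using Projectivization.ind with
    | h v hv =>
      rw [eval_rep_eq_zero_iff hx, eval_pullForm] at hq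
      rw [Projectivization.map_mk, eval_rep_eq_zero_iff hF, Projectivization.submodule_mk,
        ← hrange, Submodule.span_singleton_le_iff_mem]
      exact ⟨⟨v, rfl⟩, hq⟩
  · induction p using Projectivization.ind with
    | h y hy =>
      rw [eval_rep_eq_zero_iff hF, Projectivization.submodule_mk, ← hrange,
        Submodule.span_singleton_le_iff_mem]
      rintro ⟨⟨v, rfl⟩, hq⟩
      have hv : v ≠ 0 := fun h => hy (by rw [h, map_zero])
      refine ⟨Projectivization.mk K v hv, ?_, Projectivization.map_mk _ _ _ _⟩
      rw [eval_rep_eq_zero_iff hx, eval_pullForm]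
      exact hq

/-- A line meeting the hypersurface in finitely many points is not contained in it. -/
theorem ne_zero_of_encard_zeros [Infinite K] {f : MvPolynomial (Fin 2) K} {k : ℕ}
    (hf : {p : ℙ K (Fin 2 → K) | MvPolynomial.eval p.rep f = 0}.encard = k) : f ≠ 0 := by
  rintro rfl
  have : Infinite (ℙ K (Fin 2 → K)) := Infinite.of_injective _ (rootPoint_injective (0 : K))
  simp at hf

theorem isVersalAt_and_isMiniVersalAt [IsAlgClosed K] [CharZero K]
    {F : MvPolynomial (Fin (r + 1)) K} {d k : ℕ} (hF : F.IsHomogeneous d) (hk : 2 * (r - 1) + k = d)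
    (hbad : ∀ (m : Fin k → ℕ) (w : Matrix (Fin 2) (Fin (r + 1)) (DualNumber K))
      (l : Fin 2 → Fin (r + 1)), (∀ j, 0 < m j) → ∑ j, m j = d →
      (w.submatrix id l).det.fst ≠ 0 → ¬BadFrame F m w)
    {L : Line K r} (hL : IsIncident F k L)
    {e : Module.Basis (Fin 2 ⊕ Fin (r - 1)) K (Fin (r + 1) → K)} (he : IsAdapted L e) :
    IsVersalAt (chartCentre K r) (incidenceForm F e) ∧
      IsMiniVersalAt (chartCentre K r) (incidenceForm F e) := by
  have hinf : Infinite K := IsAlgClosed.instInfinite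
  have hcard := encard_zeros_pullForm hF hL he
  have hne := ne_zero_of_encard_zeros hcard
  have hmap := map_chartCentre_incidenceForm F e
  have hhom := isHomogeneous_pullForm hF (Matrix.of fun i => e (Sum.inl i))
  obtain ⟨n, m, α, γ, c, hα, hc, hm, hsum, hfac⟩ := exists_factorization hhom hne
  have hfac' := congrArg (changeCoord (lowerShift γ)⁻¹) hfac
  rw [changeCoord_inv_changeCoord, changeCoord_mul, changeCoord_C, changeCoord_prod] at hfac'
  simp only [changeCoord_pow, changeCoord_lowerShift_inv] at hfac'
  obtain rfl : n = k := by
    have hinj : Function.Injective fun j => rootPoint γ (α j) := (rootPoint_injective γ).comp hα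
    rw [zeros_eq_range_rootPoint hm hc hfac', ← Set.image_univ, hinj.encard_image] at hcard
    simpa using hcard
  have hfibre : HasFibre (chartCentre K r) (incidenceForm F e) m := by
    obtain ⟨p, c', hp, hc', h⟩ := exists_eq_prod_rep hα hc hfac'
    exact ⟨hm, p, c', hp, hc', hmap.trans h⟩
  obtain ⟨U, μ, hμ⟩ := exists_isUnfoldingMap (chartCentre K r) (incidenceForm F e) m hm
    (by rw [hsum, incidenceForm_eq_pullForm]; exact isHomogeneous_pullForm hF _) α hα c hc
    (lowerShift γ) (by rw [hmap]; exact hfac)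
  have hdim : Fintype.card (Fin 2 × Fin (r - 1)) = Fintype.card (Σ j, Fin (m j - 1)) := by
    have h1 := sum_sub_one_add hm
    simp only [Fintype.card_prod, Fintype.card_sigma, Fintype.card_fin]
    omega
  have key : ∀ (U : EtaleNbhd (chartCentre K r)) (μ : UnfoldingBase K m →ₐ[K] U.ring),
      IsUnfoldingMap (incidenceForm F e) m U μ →
        IsLocalIsoAt μ U.point ∧ IsSubmersionAt μ U.point := fun U μ h =>
    isLocalIsoAt_and_isSubmersionAt_of_tangent (Fintype.equivOfCardEq hdim) μ U.point
      (snd_eq_zero_of_tangent (fun w l => hbad m w l hm hsum) hne h)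
  exact ⟨⟨n, m, hfibre, ⟨U, μ, hμ, (key U μ hμ).2⟩, fun U μ h => (key U μ h).2⟩,
    ⟨n, m, hfibre, ⟨U, μ, hμ, (key U μ hμ).1⟩, fun U μ h => (key U μ h).1⟩⟩

end Line

end PointLine

end

theorem corollary2 {K : Type*} [Field K] [IsAlgClosed K] [CharZero K] (r d : ℕ)
    (hr : 1 ≤ r) (hd : 2 * r - 1 ≤ d) :
    PointLine.ForGeneralHypersurface K r d fun F =>
      ∀ L : PointLine.Line K r, PointLine.IsIncident F (d - (2 * r - 2)) L →
        PointLine.IsVersalAtLine F L ∧ PointLine.IsMiniVersalAtLine F L := by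
  have hk : 2 * (r - 1) + (d - (2 * r - 2)) = d := by omega
  let E₀ : Fin 2 ⊕ Fin (r - 1) ≃ Fin (r + 1) := Fintype.equivOfCardEq (by
    rw [Fintype.card_sum, Fintype.card_fin, Fintype.card_fin, Fintype.card_fin]
    omega)
  obtain ⟨n, Φ, hΦ0, hΦn, hΦ⟩ := PointLine.exists_hypersurface_of_badFrame (K := K) E₀ hk
  refine ⟨n, Φ, hΦ0, hΦn, fun F hF _ hFΦ L hL => ?_⟩
  have h := fun (e : Module.Basis (Fin 2 ⊕ Fin (r - 1)) K (Fin (r + 1) → K))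
      (he : PointLine.IsAdapted L e) =>
    PointLine.isVersalAt_and_isMiniVersalAt hF hk
      (fun m w l hm hsum hl hbad => hFΦ (hΦ F m w l hF hm hsum hbad hl)) hL he
  exact ⟨fun e he => (h e he).1, fun e he => (h e he).2⟩
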